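/- Let $C$ be a geometrically irreducible smooth projective curve over a finite field $\mathbb F$ with $q$ elements, with function field $K$, let $\infty$ be a closed point of $C$, and let $A=H^0(C\setminus\{\infty\},\mathcal O_C)\subset K$. (Equivalently, $K/\mathbb F$ is a finitely generated field extension of transcendence degree one in which $\mathbb F$ is algebraically closed, the closed points of $C$ are the discrete valuation rings of $K/\mathbb F$, and $A$ is the ring of elements of $K$ lying in all of these rings except possibly that of $\infty$.) Let $K_\infty$ be the completion of $K$ at $\infty$, $K_\infty^s$ a separable closure of $K_\infty$ with the norm extending that of $K_\infty$, $\mathbb C_\infty$ its completion, and $G_\infty=\operatorname{Gal}(K_\infty^s|K_\infty)$ with the profinite topology, acting by continuity on $\mathbb C_\infty$. Unlabelled tensor products are over $\mathbb F$. Let $\tau$ be the endomorphism $a\otimes r\mapsto a\otimes r^q$ of $A\otimes K$, and let $\mathfrak j$ be the kernel of $A\otimes K\to K$, $a\otimes r\mapsto ar$. An $A$-motive $\underline M=(M,\tau_M)$ over $K$ is a finite locally free $A\otimes K$-module $M$ with an $A\otimes K$-linear isomorphism $\tau_M:(\tau^*M)[\mathfrak j^{-1}]\to M[\mathfrak j^{-1}]$,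 where $N[\mathfrak j^{-1}]$ is the module of all $x\in N\otimes_{A\otimes K}\operatorname{Quot}(A\otimes K)$ with $\mathfrak j^nx\subset N$ for some $n\ge 0$; a morphism is an $A\otimes K$-linear map $f:M\to N$ with $f\circ\tau_M=\tau_N\circ\tau^*f$. A sequence of $A$-motives is exact if the underlying sequence of modules is. For a complete field $L$ with $K\subset L\subset\mathbb C_\infty$, let $L\langle A\rangle$ be the completion of $A\otimes L$ for the topology in which the subgroups $A\otimes\{c\in L:|c|\le r\}$, $r>0$, form a basis of neighbourhoods of $0$, and let $\tau$ be the continuous extension of $a\otimes c\mapsto a\otimes c^q$. The ideal $\mathfrak j$ generates the unit ideal of $\mathbb C_\infty\langle A\rangle$, so that $\tau_M$ extends to $\tau^*(M\otimes_{A\otimes K}\mathbb C_\infty\langle A\rangle)\cong M\otimes_{A\otimes K}\mathbb C_\infty\langle A\rangle$. The Betti realization of $\underline M$ is the $A$-module $$M_B=\{\omega\in M\otimes_{A\otimes K}\mathbb C_\infty\langle A\rangle \mid \omega=\tau_M(\tau^*\omega)\},$$ with the $A$-linear action of $G_\infty$ induced by its action on $\mathbb C_\infty$. The $A$-motive $\underline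 M$ is called rigid analytically trivial if the multiplication map $M_B\otimes_A\mathbb C_\infty\langle A\rangle\to M\otimes_{A\otimes K}\mathbb C_\infty\langle A\rangle$ is bijective. Then: (1) For every rigid analytically trivial $A$-motive $\underline M$ over $K$ there is a finite separable field extension $L$ of $K_\infty$ in $\mathbb C_\infty$ such that $M_B$ is contained in (the image of) $M\otimes_{A\otimes K}L\langle A\rangle$. (2) For every such $\underline M$, the action of $G_\infty$ on $M_B$, equipped with the discrete topology, is continuous. (3) The resulting functor $\underline M\mapsto M_B$, from the full subcategory of rigid analytically trivial $A$-motives over $K$ to the category of continuous $A$-linear representations of $G_\infty$ (discrete $A$-modules with a continuous $A$-linear action), is exact: it is additive and maps every short exact sequence $0\to\underline M'\to\underline M\to\underline M''\to 0$ of rigid analytically trivial $A$-motives to a short exact sequence $0\to M'_B\to M_B\to M''_B\to 0$. -/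

import Mathlib

open CategoryTheory TensorProduct
open scoped nonZeroDivisors NNReal

universe u

noncomputable section

namespace AMot

/-! ### The curve and the point at infinity

A geometrically irreducible smooth projective curve over the finite field `F` is given by its
function field `K`: a finitely generated extension of `F` of transcendence degree one in which
`F` is algebraically closed. Its closed points are the discrete valuation rings of `K / F`. -/

/-- `K` is the function field of a geometrically irreducible smooth projective curve over the
(finite, hence perfect) field `F`. -/
class IsCurveFunctionField (F K : Type u) [Field F] [Field K] [Algebra F K] : Prop where
  fg : (⊤ : IntermediateField F K).FG
  trdeg_eq_one : Algebra.trdeg F K = 1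
  constants : ∀ x : K, IsIntegral F x → x ∈ (algebraMap F K).range

/-- A closed point of the smooth projective curve with function field `K`, given by its
local ring. -/
@[ext]
structure ClosedPoint (F K : Type u) [Field F] [Field K] [Algebra F K] where
  /-- the local ring at the point -/
  localRing : ValuationSubring K
  algebraMap_mem : ∀ c : F, algebraMap F K c ∈ localRing
  isDVR : IsDiscreteValuationRing localRing

section Curve

variable {F K : Type u} [Field F] [Field K] [Algebra F K]

/-- The ring `A` of functions on the curve that are regular away from the closed point `P`. -/
def ClosedPoint.regularAway (P : ClosedPoint F K) : Subalgebra F K where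
  carrier := {x | ∀ Q : ClosedPoint F K, Q ≠ P → x ∈ Q.localRing}
  mul_mem' ha hb Q hQ := mul_mem (ha Q hQ) (hb Q hQ)
  add_mem' ha hb Q hQ := add_mem (ha Q hQ) (hb Q hQ)
  algebraMap_mem' c Q _ := Q.algebraMap_mem c

variable [Fintype F]

/-- The absolute value of `K` at `P`, normalized so that a uniformizer has absolute value
`1 / |F|` (replacing it by a power changes nothing below). -/
def ClosedPoint.abv (P : ClosedPoint F K) : AbsoluteValue K ℝ :=
  haveI := P.isDVR
  (IsDiscreteValuationRing.maximalIdeal P.localRing).adicAbv (K := K)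
    (b := (Fintype.card F : ℝ≥0)) (by exact_mod_cast Fintype.one_lt_card)

theorem ClosedPoint.isNonarchimedean_abv (P : ClosedPoint F K) : IsNonarchimedean P.abv :=
  have := P.isDVR
  (IsDiscreteValuationRing.maximalIdeal P.localRing).isNonarchimedean_adicAbv _

/-- `K_∞`, the completion of `K` at `P`. -/
def Kinf (P : ClosedPoint F K) : Type u := P.abv.Completion

variable (P : ClosedPoint F K)

instance : NormedField (Kinf P) := inferInstanceAs (NormedField P.abv.Completion)

instance : CompleteSpace (Kinf P) := inferInstanceAs (CompleteSpace P.abv.Completion)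

/-- The inclusion of `K` in `K_∞`. -/
def toKinf : K →+* Kinf P :=
  (UniformSpace.Completion.coeRingHom (α := WithAbs P.abv)).comp
    (WithAbs.equiv P.abv).symm.toRingHom

instance : Algebra K (Kinf P) := (toKinf P).toAlgebra
instance : Algebra F (Kinf P) := ((toKinf P).comp (algebraMap F K)).toAlgebra
instance : IsScalarTower F K (Kinf P) := .of_algebraMap_eq fun _ => rfl

theorem norm_toKinf (x : K) : ‖toKinf P x‖ = P.abv x :=
  (UniformSpace.Completion.norm_coe (E := WithAbs P.abv) _).trans rfl

instance : IsUltrametricDist (Kinf P) := by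
  refine IsUltrametricDist.isUltrametricDist_of_forall_norm_add_le_max_norm fun x y => ?_
  refine UniformSpace.Completion.induction_on₂ (α := WithAbs P.abv) (β := WithAbs P.abv)
    (p := fun x y : Kinf P => ‖x + y‖ ≤ max ‖x‖ ‖y‖) x y ?_ fun a b => ?_
  · exact isClosed_le ((continuous_fst.add continuous_snd).norm)
      (continuous_fst.norm.max continuous_snd.norm)
  · have h := P.isNonarchimedean_abv (WithAbs.equiv P.abv a) (WithAbs.equiv P.abv b)
    rw [← norm_toKinf, ← norm_toKinf, ← norm_toKinf, map_add] at h
    exact h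

theorem exists_one_lt_norm : ∃ x : Kinf P, 1 < ‖x‖ := by
  have := P.isDVR
  obtain ⟨r, hr, hr0⟩ := Submodule.exists_mem_ne_zero_of_ne_bot
    (IsDiscreteValuationRing.maximalIdeal P.localRing).ne_bot
  have h1 : P.abv r < 1 :=
    (IsDedekindDomain.HeightOneSpectrum.adicAbv_coe_lt_one_iff (K := K) _ _ r).2 hr
  have h0 : 0 < P.abv r := P.abv.pos (by simpa using hr0)
  refine ⟨toKinf P (r : K)⁻¹, ?_⟩
  rw [norm_toKinf, map_inv₀]
  exact (one_lt_inv₀ h0).2 h1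

instance : NontriviallyNormedField (Kinf P) where
  non_trivial := exists_one_lt_norm P

/-- `K_∞^s`, the separable closure of `K_∞`. -/
def KinfSep : Type u := SeparableClosure (Kinf P)

instance : Field (KinfSep P) := inferInstanceAs (Field (SeparableClosure (Kinf P)))
instance : Algebra (Kinf P) (KinfSep P) :=
  inferInstanceAs (Algebra (Kinf P) (SeparableClosure (Kinf P)))
instance : IsSepClosure (Kinf P) (KinfSep P) :=
  inferInstanceAs (IsSepClosure (Kinf P) (SeparableClosure (Kinf P)))
instance : Algebra.IsAlgebraic (Kinf P) (KinfSep P) :=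
  inferInstanceAs (Algebra.IsAlgebraic (Kinf P) (SeparableClosure (Kinf P)))

/-- The spectral norm on `K_∞^s`: the unique extension of the norm of `K_∞`. -/
instance : NormedField (KinfSep P) := spectralNorm.normedField (Kinf P) (KinfSep P)

/-- `ℂ_∞`, the completion of the separable closure `K_∞^s` of `K_∞`. -/
def Cinf : Type u := UniformSpace.Completion (KinfSep P)

instance : NormedField (Cinf P) :=
  inferInstanceAs (NormedField (UniformSpace.Completion (KinfSep P)))

instance : CompleteSpace (Cinf P) :=
  inferInstanceAs (CompleteSpace (UniformSpace.Completion (KinfSep P)))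

/-- The inclusion of `K_∞^s` in `ℂ_∞`. -/
def toCinf : KinfSep P →+* Cinf P :=
  UniformSpace.Completion.coeRingHom

instance : Algebra (KinfSep P) (Cinf P) := (toCinf P).toAlgebra
instance : Algebra (Kinf P) (Cinf P) :=
  ((toCinf P).comp (algebraMap (Kinf P) (KinfSep P))).toAlgebra
instance : Algebra K (Cinf P) := ((algebraMap (Kinf P) (Cinf P)).comp (toKinf P)).toAlgebra
instance : Algebra F (Cinf P) := ((algebraMap K (Cinf P)).comp (algebraMap F K)).toAlgebra
instance : IsScalarTower (Kinf P) (KinfSep P) (Cinf P) :=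
  .of_algebraMap_eq fun _ => rfl
instance : IsScalarTower K (Kinf P) (Cinf P) := .of_algebraMap_eq fun _ => rfl
instance : IsScalarTower F (Kinf P) (Cinf P) := .of_algebraMap_eq fun _ => rfl
instance : IsScalarTower F K (Cinf P) := .of_algebraMap_eq fun _ => rfl

instance (L : IntermediateField (Kinf P) (Cinf P)) : IsScalarTower F K L :=
  .of_algebraMap_eq fun _ => rfl

/-- `G_∞ = Gal(K_∞^s / K_∞)`, a topological group for the Krull topology. -/
abbrev Ginf : Type u := Gal(KinfSep P/Kinf P)

theorem continuous_galois (σ : Ginf P) : Continuous σ := by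
  refine Isometry.continuous (AddMonoidHomClass.isometry_of_norm σ fun x => ?_)
  exact (spectralNorm_eq_of_equiv σ x).symm

/-- The action of `G_∞` on `ℂ_∞`, obtained by continuity. -/
def galCinf (σ : Ginf P) : Cinf P →ₐ[Kinf P] Cinf P where
  __ := UniformSpace.Completion.mapRingHom
    (σ : KinfSep P →+* KinfSep P) (continuous_galois P σ)
  commutes' x := by
    refine (UniformSpace.Completion.mapRingHom_coe (continuous_galois P σ) _).trans ?_
    exact congrArg _ (σ.commutes x)

theorem continuous_galCinf (σ : Ginf P) : Continuous (galCinf P σ) :=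
  UniformSpace.Completion.continuous_map

theorem galCinf_toCinf (σ : Ginf P) (x : KinfSep P) :
    galCinf P σ (toCinf P x) = toCinf P (σ x) :=
  UniformSpace.Completion.mapRingHom_coe (continuous_galois P σ) x

theorem denseRange_toCinf : DenseRange (toCinf P) :=
  UniformSpace.Completion.denseRange_coe (α := KinfSep P)

theorem galCinf_one (x : Cinf P) : galCinf P 1 x = x :=
  congrFun ((denseRange_toCinf P).equalizer (continuous_galCinf P 1) continuous_id
    (funext fun y => galCinf_toCinf P 1 y)) x

theorem galCinf_mul (σ σ' : Ginf P) (x : Cinf P) :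
    galCinf P (σ * σ') x = galCinf P σ (galCinf P σ' x) :=
  congrFun ((denseRange_toCinf P).equalizer (continuous_galCinf P (σ * σ'))
    ((continuous_galCinf P σ).comp (continuous_galCinf P σ'))
    (funext fun y => by
      simp only [Function.comp_apply, galCinf_toCinf, AlgEquiv.mul_apply])) x

end Curve

section Tate

/-! ### Tate algebras

For a complete nonarchimedean field `L` over `F`, the Tate algebra `L⟨A⟩` is the completion of
`A ⊗ L` for the topology in which the subgroups `A ⊗ {c | ‖c‖ ≤ r}`, `r > 0`, form a basis of
neighbourhoods of zero. (It is `L ⊗_{𝒪_L} 𝒪_L⟨A⟩`, where `𝒪_L⟨A⟩` is the completion of `A ⊗ 𝒪_L`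
for the topology induced by the norm of `L`.) -/

variable (F A L : Type u) [Field F] [CommRing A] [Algebra F A] [NormedField L] [Algebra F L]

/-- `A ⊗ L`, to be equipped with its norm topology. -/
def PreTate : Type u := A ⊗[F] L

instance : CommRing (PreTate F A L) := inferInstanceAs (CommRing (A ⊗[F] L))

/-- The identity of `A ⊗ L`. -/
def PreTate.of : A ⊗[F] L ≃+* PreTate F A L := RingEquiv.refl (A ⊗[F] L)

/-- The image of `A ⊗ {c | ‖c‖ ≤ r}` in `A ⊗ L`. -/
def PreTate.ball (r : {r : ℝ // 0 < r}) : AddSubgroup (PreTate F A L) :=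
  AddSubgroup.closure {x | ∃ (a : A) (c : L), ‖c‖ ≤ r ∧ x = PreTate.of F A L (a ⊗ₜ c)}

variable {F A L} in
theorem PreTate.tmul_mem_ball {r : {r : ℝ // 0 < r}} (a : A) {c : L} (hc : ‖c‖ ≤ r) :
    PreTate.of F A L (a ⊗ₜ c) ∈ PreTate.ball F A L r :=
  AddSubgroup.subset_closure ⟨a, c, hc, rfl⟩

theorem PreTate.ball_mono {r s : {r : ℝ // 0 < r}} (h : r ≤ s) :
    PreTate.ball F A L r ≤ PreTate.ball F A L s :=
  AddSubgroup.closure_mono fun _ ⟨a, c, hc, hx⟩ => ⟨a, c, hc.trans h, hx⟩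

theorem PreTate.ball_mul {r s t : {r : ℝ // 0 < r}} (h : (r : ℝ) * s ≤ t) {x y : PreTate F A L}
    (hx : x ∈ PreTate.ball F A L r) (hy : y ∈ PreTate.ball F A L s) :
    x * y ∈ PreTate.ball F A L t := by
  induction hx using AddSubgroup.closure_induction with
  | zero => simp
  | add x x' _ _ h1 h2 => rw [add_mul]; exact add_mem h1 h2
  | neg x _ h1 => rw [neg_mul]; exact neg_mem h1
  | mem x hx =>
    obtain ⟨a, c, hc, rfl⟩ := hx
    induction hy using AddSubgroup.closure_induction with
    | zero => simp
    | add y y' _ _ h1 h2 => rw [mul_add]; exact add_mem h1 h2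
    | neg y _ h1 => rw [mul_neg]; exact neg_mem h1
    | mem y hy =>
      obtain ⟨b, d, hd, rfl⟩ := hy
      rw [← map_mul, Algebra.TensorProduct.tmul_mul_tmul]
      refine PreTate.tmul_mem_ball _ ?_
      rw [norm_mul]
      exact (mul_le_mul hc hd (norm_nonneg _) r.2.le).trans h

theorem PreTate.exists_mem_ball (x : PreTate F A L) : ∃ r, x ∈ PreTate.ball F A L r := by
  obtain ⟨x, rfl⟩ := (PreTate.of F A L).surjective x
  induction x using TensorProduct.induction_on with
  | zero => exact ⟨⟨1, one_pos⟩, by rw [map_zero]; exact zero_mem _⟩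
  | tmul a c =>
    exact ⟨⟨‖c‖ + 1, by positivity⟩, PreTate.tmul_mem_ball a (by simp)⟩
  | add x y hx hy =>
    obtain ⟨r, hr⟩ := hx
    obtain ⟨s, hs⟩ := hy
    exact ⟨r ⊔ s, by
      rw [map_add]
      exact add_mem (PreTate.ball_mono F A L le_sup_left hr)
        (PreTate.ball_mono F A L le_sup_right hs)⟩

instance : Nonempty {r : ℝ // 0 < r} := ⟨⟨1, one_pos⟩⟩

theorem PreTate.ringSubgroupsBasis : RingSubgroupsBasis (PreTate.ball F A L) := by
  refine RingSubgroupsBasis.of_comm _ (fun r s => ⟨r ⊓ s, le_inf ?_ ?_⟩) (fun r => ?_)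
    fun x r => ?_
  · exact PreTate.ball_mono F A L inf_le_left
  · exact PreTate.ball_mono F A L inf_le_right
  · refine ⟨r ⊓ ⟨1, one_pos⟩, ?_⟩
    rintro _ ⟨x, hx, y, hy, rfl⟩
    refine PreTate.ball_mul F A L (r := r ⊓ ⟨1, one_pos⟩) (s := ⟨1, one_pos⟩) ?_ hx
      (PreTate.ball_mono F A L inf_le_right hy)
    exact (mul_one _).trans_le (inf_le_left : r ⊓ ⟨1, one_pos⟩ ≤ r)
  · obtain ⟨s, hs⟩ := PreTate.exists_mem_ball F A L x
    refine ⟨⟨r / s, div_pos r.2 s.2⟩, fun y hy => ?_⟩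
    exact PreTate.ball_mul F A L (mul_div_cancel₀ _ s.2.ne').le hs hy

instance : TopologicalSpace (PreTate F A L) := (PreTate.ringSubgroupsBasis F A L).topology

instance : IsTopologicalRing (PreTate F A L) :=
  (PreTate.ringSubgroupsBasis F A L).toRingFilterBasis.isTopologicalRing

instance : UniformSpace (PreTate F A L) := IsTopologicalAddGroup.rightUniformSpace _

instance : IsUniformAddGroup (PreTate F A L) := isUniformAddGroup_of_addCommGroup

/-- The Tate algebra `L⟨A⟩`. -/
def Tate : Type u := UniformSpace.Completion (PreTate F A L)

instance : CommRing (Tate F A L) :=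
  inferInstanceAs (CommRing (UniformSpace.Completion (PreTate F A L)))

instance : UniformSpace (Tate F A L) :=
  inferInstanceAs (UniformSpace (UniformSpace.Completion (PreTate F A L)))

instance : T2Space (Tate F A L) :=
  inferInstanceAs (T2Space (UniformSpace.Completion (PreTate F A L)))

/-- The canonical map `A ⊗ L → L⟨A⟩`. -/
def toTate : A ⊗[F] L →+* Tate F A L :=
  (UniformSpace.Completion.coeRingHom (α := PreTate F A L)).comp (PreTate.of F A L).toRingHom

theorem denseRange_toTate : DenseRange (toTate F A L) :=
  (UniformSpace.Completion.denseRange_coe (α := PreTate F A L)).comp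
    (PreTate.of F A L).surjective.denseRange (UniformSpace.Completion.continuous_coe _)

variable {L} {L' : Type u} [NormedField L'] [Algebra F L']

/-- `id ⊗ g : A ⊗ L → A ⊗ L'`. -/
def PreTate.map (g : L →ₐ[F] L') : PreTate F A L →+* PreTate F A L' :=
  ((PreTate.of F A L').toRingHom.comp
    (Algebra.TensorProduct.map (AlgHom.id F A) g : A ⊗[F] L →ₐ[F] A ⊗[F] L').toRingHom).comp
    (PreTate.of F A L).symm.toRingHom

theorem PreTate.map_of (g : L →ₐ[F] L') (x : A ⊗[F] L) :
    PreTate.map F A g (PreTate.of F A L x) =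
      PreTate.of F A L' (Algebra.TensorProduct.map (AlgHom.id F A) g x) := rfl

theorem PreTate.continuous_map (g : L →ₐ[F] L') (hg : Continuous g) :
    Continuous (PreTate.map F A g) := by
  refine continuous_of_continuousAt_zero _ ?_
  have h := (PreTate.ringSubgroupsBasis F A L).hasBasis_nhds_zero
  have h' := (PreTate.ringSubgroupsBasis F A L').hasBasis_nhds_zero
  rw [ContinuousAt, map_zero]
  refine (h.tendsto_iff h').2 fun r _ => ?_
  obtain ⟨δ, hδ, hd⟩ := Metric.continuousAt_iff.1 (hg.continuousAt (x := (0 : L))) r r.2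
  refine ⟨⟨δ / 2, half_pos hδ⟩, trivial, fun x hx => ?_⟩
  induction hx using AddSubgroup.closure_induction with
  | zero => rw [map_zero]; exact zero_mem _
  | add x y _ _ h1 h2 => rw [map_add]; exact add_mem h1 h2
  | neg x _ h1 => rw [map_neg]; exact neg_mem h1
  | mem x hx =>
    obtain ⟨a, c, hc, rfl⟩ := hx
    have hc' : dist c 0 < δ := by rw [dist_zero_right]; exact hc.trans_lt (half_lt_self hδ)
    have := hd hc'
    rw [map_zero, dist_zero_right] at this
    rw [PreTate.map_of, Algebra.TensorProduct.map_tmul]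
    exact PreTate.tmul_mem_ball _ this.le

/-- The map `L⟨A⟩ → L'⟨A⟩` induced by a continuous `F`-algebra morphism `L → L'`. -/
def Tate.map (g : L →ₐ[F] L') (hg : Continuous g) : Tate F A L →+* Tate F A L' :=
  UniformSpace.Completion.mapRingHom (PreTate.map F A g) (PreTate.continuous_map F A g hg)

theorem Tate.continuous_map (g : L →ₐ[F] L') (hg : Continuous g) :
    Continuous (Tate.map F A g hg) :=
  UniformSpace.Completion.continuous_map

theorem Tate.map_toTate (g : L →ₐ[F] L') (hg : Continuous g) (x : A ⊗[F] L) :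
    Tate.map F A g hg (toTate F A L x) =
      toTate F A L' (Algebra.TensorProduct.map (AlgHom.id F A) g x) :=
  UniformSpace.Completion.mapRingHom_coe (PreTate.continuous_map F A g hg) (PreTate.of F A L x)

variable {F A} in
theorem Tate.hom_ext {X : Type*} [TopologicalSpace X] [T2Space X] {f g : Tate F A L → X}
    (hf : Continuous f) (hg : Continuous g)
    (h : ∀ x, f (toTate F A L x) = g (toTate F A L x)) : f = g :=
  (denseRange_toTate F A L).equalizer hf hg (funext h)

variable (L)
variable (K : Type u) [Field K] [Algebra F K] [Algebra K L] [IsScalarTower F K L]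

instance : Algebra (A ⊗[F] K) (Tate F A L) :=
  ((toTate F A L).comp (Algebra.TensorProduct.map (AlgHom.id F A)
    (IsScalarTower.toAlgHom F K L) : A ⊗[F] K →ₐ[F] A ⊗[F] L).toRingHom).toAlgebra

instance : Algebra A (Tate F A L) :=
  ((toTate F A L).comp (Algebra.TensorProduct.includeLeft : A →ₐ[F] A ⊗[F] L).toRingHom).toAlgebra

theorem Tate.algebraMap_tmul (a : A) (r : K) :
    algebraMap (A ⊗[F] K) (Tate F A L) (a ⊗ₜ r) = toTate F A L (a ⊗ₜ algebraMap K L r) := rfl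

instance : IsScalarTower A (A ⊗[F] K) (Tate F A L) := .of_algebraMap_eq fun a => by
  rw [Algebra.TensorProduct.algebraMap_apply, Tate.algebraMap_tmul, map_one]; rfl

variable {L}
variable [Algebra K L'] [IsScalarTower F K L']

/-- The map `L⟨A⟩ → L'⟨A⟩` induced by a continuous `K`-algebra morphism `L → L'`, as an
`A ⊗ K`-algebra morphism. -/
def Tate.mapAlg (g : L →ₐ[K] L') (hg : Continuous g) :
    Tate F A L →ₐ[A ⊗[F] K] Tate F A L' where
  __ := Tate.map F A (g.restrictScalars F) (show Continuous (g.restrictScalars F) from hg)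
  commutes' x := by
    change Tate.map F A (g.restrictScalars F)
      (show Continuous (g.restrictScalars F) from hg) (algebraMap _ _ x) = _
    induction x using TensorProduct.induction_on with
    | zero => simp
    | add x y hx hy => simp only [map_add, hx, hy]
    | tmul a r =>
      rw [Tate.algebraMap_tmul, Tate.map_toTate, Algebra.TensorProduct.map_tmul,
        Tate.algebraMap_tmul]
      exact congrArg (fun c => toTate F A L' (a ⊗ₜ c)) (g.commutes r)

theorem Tate.continuous_mapAlg (g : L →ₐ[K] L') (hg : Continuous g) :
    Continuous (Tate.mapAlg F A K g hg) := Tate.continuous_map F A _ hg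

theorem Tate.mapAlg_toTate (g : L →ₐ[K] L') (hg : Continuous g) (x : A ⊗[F] L) :
    Tate.mapAlg F A K g hg (toTate F A L x) = toTate F A L'
      (Algebra.TensorProduct.map (AlgHom.id F A) (g.restrictScalars F) x) :=
  Tate.map_toTate F A _ hg x

variable (L) [Fintype F]

theorem continuous_frobeniusAlgHom {F : Type u} [Field F] (L : Type u) [NormedField L]
    [Algebra F L] [Fintype F] : Continuous (FiniteField.frobeniusAlgHom F L) :=
  continuous_pow (Fintype.card F)

/-- The endomorphism `τ` of `L⟨A⟩` extending `a ⊗ c ↦ a ⊗ c ^ q`, where `q = |F|`. -/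
def Tate.frob : Tate F A L →+* Tate F A L :=
  Tate.map F A (FiniteField.frobeniusAlgHom F L) (continuous_frobeniusAlgHom L)

theorem Tate.frob_tmul (a : A) (c : L) :
    Tate.frob F A L (toTate F A L (a ⊗ₜ c)) = toTate F A L (a ⊗ₜ (c ^ Fintype.card F)) :=
  Tate.map_toTate F A _ (continuous_frobeniusAlgHom L) _

theorem Tate.continuous_frob : Continuous (Tate.frob F A L) := Tate.continuous_map ..

/-- The endomorphism `τ` of `A ⊗ K`, `a ⊗ r ↦ a ⊗ r ^ q`, where `q = |F|`. -/
def tensorFrob : A ⊗[F] K →+* A ⊗[F] K :=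
  (Algebra.TensorProduct.map (AlgHom.id F A) (FiniteField.frobeniusAlgHom F K) :
    A ⊗[F] K →ₐ[F] A ⊗[F] K)

theorem Tate.frob_algebraMap (x : A ⊗[F] K) :
    Tate.frob F A L (algebraMap (A ⊗[F] K) (Tate F A L) x) =
      algebraMap (A ⊗[F] K) (Tate F A L) (tensorFrob F A K x) := by
  induction x using TensorProduct.induction_on with
  | zero => simp
  | add x y hx hy => simp only [map_add, hx, hy]
  | tmul a r =>
    rw [Tate.algebraMap_tmul, Tate.frob_tmul, ← map_pow]
    rfl

/-- `τ` on `L⟨A⟩` as a map semilinear over `τ` on `A ⊗ K`. -/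
def Tate.frobₛₗ : Tate F A L →ₛₗ[tensorFrob F A K] Tate F A L where
  __ := Tate.frob F A L
  map_smul' x y := by
    change Tate.frob F A L (x • y) = tensorFrob F A K x • Tate.frob F A L y
    rw [Algebra.smul_def, Algebra.smul_def, map_mul, Tate.frob_algebraMap]

variable {L}

theorem Tate.mapAlg_frob (g : L →ₐ[K] L') (hg : Continuous g) (x : Tate F A L) :
    Tate.mapAlg F A K g hg (Tate.frob F A L x) = Tate.frob F A L' (Tate.mapAlg F A K g hg x) := by
  refine congrFun (Tate.hom_ext (f := fun x => Tate.mapAlg F A K g hg (Tate.frob F A L x))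
    (g := fun x => Tate.frob F A L' (Tate.mapAlg F A K g hg x))
    ((Tate.continuous_mapAlg F A K g hg).comp (Tate.continuous_frob F A L))
    ((Tate.continuous_frob F A L').comp (Tate.continuous_mapAlg F A K g hg)) fun y => ?_) x
  induction y using TensorProduct.induction_on with
  | zero => simp
  | add y z hy hz => simp only [map_add, hy, hz]
  | tmul a c =>
    rw [Tate.frob_tmul, Tate.mapAlg_toTate, Tate.mapAlg_toTate, Algebra.TensorProduct.map_tmul,
      Algebra.TensorProduct.map_tmul, Tate.frob_tmul, map_pow]

end Tate

section Motive

/-! ### `A`-motives -/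

section Pullback

variable {R : Type u} [CommRing R] (φ : R →+* R)

/-- A copy of the ring `R`, which is an `R`-algebra through `φ`. -/
def TwistedRing (_ : R →+* R) : Type u := R

instance : CommRing (TwistedRing φ) := inferInstanceAs (CommRing R)

/-- The identity from `R` to its copy `TwistedRing φ`. -/
def TwistedRing.of : R ≃+* TwistedRing φ := RingEquiv.refl R

instance : Algebra R (TwistedRing φ) := ((TwistedRing.of φ).toRingHom.comp φ).toAlgebra

/-- The pullback `φ^* N = R ⊗_{φ, R} N`. -/
def Pullback (N : Type u) [AddCommGroup N] [Module R N] : Type u := TwistedRing φ ⊗[R] N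

variable (N : Type u) [AddCommGroup N] [Module R N]

instance : AddCommGroup (Pullback φ N) := inferInstanceAs (AddCommGroup (TwistedRing φ ⊗[R] N))

/-- `R` acts on `φ^* N = R ⊗_{φ, R} N` by multiplication on the first factor. -/
instance : Module R (Pullback φ N) :=
  Module.compHom (TwistedRing φ ⊗[R] N) (TwistedRing.of φ).toRingHom

/-- The `φ`-semilinear map `N → φ^* N`, `n ↦ 1 ⊗ n`. -/
def Pullback.mk : N →ₛₗ[φ] Pullback φ N where
  toFun n := ((1 : TwistedRing φ) ⊗ₜ[R] n : TwistedRing φ ⊗[R] N)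
  map_add' x y := TensorProduct.tmul_add _ x y
  map_smul' r x := by
    refine (TensorProduct.smul_tmul r (1 : TwistedRing φ) x).symm.trans ?_
    exact (TensorProduct.smul_tmul' (TwistedRing.of φ (φ r)) (1 : TwistedRing φ) x).symm

variable {N} {N' N'' : Type u} [AddCommGroup N'] [Module R N'] [AddCommGroup N''] [Module R N'']

/-- The pullback `φ^* f` of a linear map. -/
def Pullback.map (f : N →ₗ[R] N') : Pullback φ N →ₗ[R] Pullback φ N' where
  toFun x := LinearMap.baseChange (TwistedRing φ) f x
  map_add' x y := map_add (LinearMap.baseChange (TwistedRing φ) f) x y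
  map_smul' r x := map_smul (LinearMap.baseChange (TwistedRing φ) f) (TwistedRing.of φ r)
    (show TwistedRing φ ⊗[R] N from x)

theorem Pullback.map_mk (f : N →ₗ[R] N') (x : N) :
    Pullback.map φ f (Pullback.mk φ N x) = Pullback.mk φ N' (f x) :=
  LinearMap.baseChange_tmul (A := TwistedRing φ) (f := f) 1 x

theorem Pullback.map_id : Pullback.map φ (LinearMap.id : N →ₗ[R] N) = LinearMap.id := by
  ext x
  exact LinearMap.congr_fun (LinearMap.baseChange_id (A := TwistedRing φ) (M := N)) x

theorem Pullback.map_comp (g : N' →ₗ[R] N'') (f : N →ₗ[R] N') :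
    Pullback.map φ (g ∘ₗ f) = Pullback.map φ g ∘ₗ Pullback.map φ f := by
  ext x
  exact LinearMap.congr_fun (LinearMap.baseChange_comp (A := TwistedRing φ) (f := f) (g := g)) x

theorem Pullback.map_add (f g : N →ₗ[R] N') :
    Pullback.map φ (f + g) = Pullback.map φ f + Pullback.map φ g := by
  ext x
  exact LinearMap.congr_fun (LinearMap.baseChange_add (A := TwistedRing φ) (f := f) (g := g)) x

theorem Pullback.map_zero : Pullback.map φ (0 : N →ₗ[R] N') = 0 := by
  ext x
  exact LinearMap.congr_fun (LinearMap.baseChange_zero (A := TwistedRing φ) (R := R)) x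

theorem Pullback.map_neg (f : N →ₗ[R] N') : Pullback.map φ (-f) = -Pullback.map φ f := by
  ext x
  exact LinearMap.congr_fun (LinearMap.baseChange_neg (A := TwistedRing φ) (f := f)) x

end Pullback

section Poles

variable {R : Type u} [CommRing R] (j : Ideal R) (N : Type u) [AddCommGroup N] [Module R N]

/-- `N[j⁻¹]`: the submodule of `N ⊗ Quot(R)` of the elements `x` such that `j ^ n x ⊆ N` for
some `n`. For `N` finite locally free and `V(j)` a Cartier divisor, these are the sections of `N`
over `Spec R ∖ V(j)`. -/
def InvAlong : Submodule R (LocalizedModule R⁰ N) where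
  carrier := {x | ∃ n : ℕ, ∀ a ∈ j ^ n, a • x ∈ LinearMap.range (LocalizedModule.mkLinearMap R⁰ N)}
  zero_mem' := ⟨0, fun a _ => by rw [smul_zero]; exact zero_mem _⟩
  add_mem' := by
    rintro x y ⟨n, hn⟩ ⟨m, hm⟩
    refine ⟨n + m, fun a ha => ?_⟩
    rw [smul_add]
    exact add_mem (hn a (Ideal.pow_le_pow_right (Nat.le_add_right n m) ha))
      (hm a (Ideal.pow_le_pow_right (Nat.le_add_left m n) ha))
  smul_mem' := by
    rintro r x ⟨n, hn⟩
    refine ⟨n, fun a ha => ?_⟩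
    rw [smul_comm]
    exact Submodule.smul_mem _ r (hn a ha)

/-- The canonical map `N → N[j⁻¹]`. -/
def InvAlong.ι : N →ₗ[R] InvAlong j N :=
  (LocalizedModule.mkLinearMap R⁰ N).codRestrict _ fun x =>
    ⟨0, fun a _ => Submodule.smul_mem _ a ⟨x, rfl⟩⟩

variable {N} {N' N'' : Type u} [AddCommGroup N'] [Module R N'] [AddCommGroup N''] [Module R N'']

/-- The map `N ⊗ Quot(R) → N' ⊗ Quot(R)` induced by a linear map. -/
def locMap (f : N →ₗ[R] N') : LocalizedModule R⁰ N →ₗ[R] LocalizedModule R⁰ N' :=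
  IsLocalizedModule.map R⁰ (LocalizedModule.mkLinearMap R⁰ N) (LocalizedModule.mkLinearMap R⁰ N') f

theorem locMap_mk (f : N →ₗ[R] N') (x : N) :
    locMap f (LocalizedModule.mkLinearMap R⁰ N x) = LocalizedModule.mkLinearMap R⁰ N' (f x) :=
  IsLocalizedModule.map_apply ..

/-- The map `N[j⁻¹] → N'[j⁻¹]` induced by a linear map. -/
def InvAlong.map (f : N →ₗ[R] N') : InvAlong j N →ₗ[R] InvAlong j N' :=
  (locMap f).restrict <| by
    rintro x ⟨n, hn⟩
    refine ⟨n, fun a ha => ?_⟩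
    obtain ⟨y, hy⟩ := hn a ha
    exact ⟨f y, by rw [← map_smul, ← hy, locMap_mk]⟩

theorem InvAlong.map_ι (f : N →ₗ[R] N') (x : N) :
    InvAlong.map j f (InvAlong.ι j N x) = InvAlong.ι j N' (f x) :=
  Subtype.ext (locMap_mk f x)

theorem InvAlong.map_id : InvAlong.map j (LinearMap.id : N →ₗ[R] N) = LinearMap.id := by
  ext x
  exact LinearMap.congr_fun (IsLocalizedModule.map_id R⁰ (LocalizedModule.mkLinearMap R⁰ N)) x.1

theorem InvAlong.map_comp (g : N' →ₗ[R] N'') (f : N →ₗ[R] N') :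
    InvAlong.map j (g ∘ₗ f) = InvAlong.map j g ∘ₗ InvAlong.map j f := by
  ext x
  exact LinearMap.congr_fun (IsLocalizedModule.map_comp' R⁰ (LocalizedModule.mkLinearMap R⁰ N)
    (LocalizedModule.mkLinearMap R⁰ N') (LocalizedModule.mkLinearMap R⁰ N'') f g) x.1

theorem InvAlong.map_add (f g : N →ₗ[R] N') :
    InvAlong.map j (f + g) = InvAlong.map j f + InvAlong.map j g := by
  ext x
  exact LinearMap.congr_fun (_root_.map_add (IsLocalizedModule.map R⁰
    (LocalizedModule.mkLinearMap R⁰ N) (LocalizedModule.mkLinearMap R⁰ N')) f g) x.1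

theorem InvAlong.map_zero : InvAlong.map j (0 : N →ₗ[R] N') = 0 := by
  ext x
  exact LinearMap.congr_fun (_root_.map_zero (IsLocalizedModule.map R⁰
    (LocalizedModule.mkLinearMap R⁰ N) (LocalizedModule.mkLinearMap R⁰ N'))) x.1

theorem InvAlong.map_neg (f : N →ₗ[R] N') : InvAlong.map j (-f) = -InvAlong.map j f := by
  ext x
  exact LinearMap.congr_fun (_root_.map_neg (IsLocalizedModule.map R⁰
    (LocalizedModule.mkLinearMap R⁰ N) (LocalizedModule.mkLinearMap R⁰ N')) f) x.1

end Poles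

variable (F A K : Type u) [Field F] [Fintype F] [CommRing A] [Algebra F A] [Field K] [Algebra F K]
  [Algebra A K] [IsScalarTower F A K]

/-- The ideal `𝔧`, the kernel of `A ⊗ K → K`, `a ⊗ r ↦ a r`. -/
def idealJ : Ideal (A ⊗[F] K) :=
  RingHom.ker (Algebra.TensorProduct.productMap (IsScalarTower.toAlgHom F A K) (AlgHom.id F K))

/-- An Anderson `A`-motive over `K`: a finite locally free `A ⊗ K`-module `M` together with an
isomorphism `τ_M : (τ^* M)[𝔧⁻¹] ≃ M[𝔧⁻¹]`. -/
structure AMotive where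
  /-- the underlying module -/
  carrier : Type u
  [addCommGroup : AddCommGroup carrier]
  [module : Module (A ⊗[F] K) carrier]
  [finite : Module.Finite (A ⊗[F] K) carrier]
  [projective : Module.Projective (A ⊗[F] K) carrier]
  /-- the isomorphism `τ_M` -/
  τ : InvAlong (idealJ F A K) (Pullback (tensorFrob F A K) carrier) ≃ₗ[A ⊗[F] K]
    InvAlong (idealJ F A K) carrier

attribute [instance] AMotive.addCommGroup AMotive.module AMotive.finite AMotive.projective

namespace AMotive

variable {F A K}

/-- Morphisms of `A`-motives: `A ⊗ K`-linear maps `f` such that `f ∘ τ_M = τ_N ∘ τ^* f`. -/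
@[ext]
structure Hom (M N : AMotive F A K) where
  /-- the underlying linear map -/
  lin : M.carrier →ₗ[A ⊗[F] K] N.carrier
  comm : InvAlong.map (idealJ F A K) lin ∘ₗ M.τ.toLinearMap =
    N.τ.toLinearMap ∘ₗ InvAlong.map (idealJ F A K) (Pullback.map (tensorFrob F A K) lin)

instance : Category (AMotive F A K) where
  Hom := Hom
  id M := ⟨LinearMap.id, by
    rw [Pullback.map_id, InvAlong.map_id, InvAlong.map_id]; rfl⟩
  comp f g := ⟨g.lin ∘ₗ f.lin, by
    rw [Pullback.map_comp, InvAlong.map_comp, InvAlong.map_comp, LinearMap.comp_assoc, f.comm,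
      ← LinearMap.comp_assoc, g.comm, LinearMap.comp_assoc]⟩

variable {M N : AMotive F A K}

theorem hom_ext {f g : M ⟶ N} (h : f.lin = g.lin) : f = g := Hom.ext h

theorem id_lin (M : AMotive F A K) : Hom.lin (𝟙 M) = LinearMap.id := rfl
theorem comp_lin {M N Q : AMotive F A K} (f : M ⟶ N) (g : N ⟶ Q) :
    (f ≫ g).lin = g.lin ∘ₗ f.lin := rfl

/-- The morphisms `M → N` as a subgroup of the group of linear maps. -/
def homSubgroup (M N : AMotive F A K) : AddSubgroup (M.carrier →ₗ[A ⊗[F] K] N.carrier) where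
  carrier := {f | InvAlong.map (idealJ F A K) f ∘ₗ M.τ.toLinearMap =
    N.τ.toLinearMap ∘ₗ InvAlong.map (idealJ F A K) (Pullback.map (tensorFrob F A K) f)}
  zero_mem' := by
    change _ = _
    rw [Pullback.map_zero, InvAlong.map_zero, InvAlong.map_zero, LinearMap.zero_comp,
      LinearMap.comp_zero]
  add_mem' {f g} hf hg := by
    change _ = _ at hf hg ⊢
    rw [Pullback.map_add, InvAlong.map_add, InvAlong.map_add, LinearMap.add_comp,
      LinearMap.comp_add, hf, hg]
  neg_mem' {f} hf := by
    change _ = _ at hf ⊢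
    rw [Pullback.map_neg, InvAlong.map_neg, InvAlong.map_neg, LinearMap.neg_comp,
      LinearMap.comp_neg, hf]

/-- Morphisms as elements of `homSubgroup`. -/
def homEquiv (M N : AMotive F A K) : (M ⟶ N) ≃ homSubgroup M N where
  toFun f := ⟨f.lin, f.comm⟩
  invFun f := ⟨f.1, f.2⟩
  left_inv _ := rfl
  right_inv _ := rfl

instance (M N : AMotive F A K) : AddCommGroup (M ⟶ N) := (homEquiv M N).addCommGroup

theorem add_lin (f g : M ⟶ N) : (f + g).lin = f.lin + g.lin := rfl

instance : Preadditive (AMotive F A K) where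
  add_comp _ _ _ f f' g := hom_ext (LinearMap.comp_add f.lin f'.lin g.lin)
  comp_add _ _ _ f g g' := hom_ext (LinearMap.add_comp f.lin g'.lin g.lin)

end AMotive

end Motive

section Betti

/-! ### Betti realization -/

variable {F A K : Type u} [Field F] [Fintype F] [CommRing A] [Algebra F A] [Field K] [Algebra F K]
  [Algebra A K] [IsScalarTower F A K] (M : AMotive F A K)
  (L : Type u) [NormedField L] [Algebra F L] [Algebra K L] [IsScalarTower F K L]

namespace AMotive

/-- `M ⊗_{A ⊗ K} L⟨A⟩`. -/
abbrev Ext : Type u := Tate F A L ⊗[A ⊗[F] K] M.carrier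

/-- `ω ↦ τ^* ω`, from `M ⊗ L⟨A⟩` to `τ^*(M ⊗ L⟨A⟩) = (τ^* M) ⊗ L⟨A⟩`. -/
def pullExt : M.Ext L →ₛₗ[tensorFrob F A K]
    Tate F A L ⊗[A ⊗[F] K] Pullback (tensorFrob F A K) M.carrier :=
  TensorProduct.map (Tate.frobₛₗ F A L K) (Pullback.mk (tensorFrob F A K) M.carrier)

/-- The map `M ⊗ L⟨A⟩ → M[𝔧⁻¹] ⊗ L⟨A⟩`. It is bijective as soon as `𝔧` generates the unit ideal of
`L⟨A⟩`, for instance for `L = ℂ_∞`. -/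
def toInv : M.Ext L →ₗ[A ⊗[F] K] Tate F A L ⊗[A ⊗[F] K] InvAlong (idealJ F A K) M.carrier :=
  LinearMap.lTensor (Tate F A L) (InvAlong.ι (idealJ F A K) M.carrier)

/-- `τ_M ⊗ id`, as a map `(τ^* M) ⊗ L⟨A⟩ → M[𝔧⁻¹] ⊗ L⟨A⟩`. -/
def τExt : Tate F A L ⊗[A ⊗[F] K] Pullback (tensorFrob F A K) M.carrier →ₗ[A ⊗[F] K]
    Tate F A L ⊗[A ⊗[F] K] InvAlong (idealJ F A K) M.carrier :=
  LinearMap.lTensor (Tate F A L)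
    (M.τ.toLinearMap ∘ₗ InvAlong.ι (idealJ F A K) (Pullback (tensorFrob F A K) M.carrier))

/-- The Betti realization `M_B = {ω ∈ M ⊗ L⟨A⟩ | ω = τ_M(τ^* ω)}`, to be used for `L = ℂ_∞`.
The equation is written in `M[𝔧⁻¹] ⊗ L⟨A⟩`, which is the same module as `M ⊗ L⟨A⟩` when `𝔧` is
invertible in `L⟨A⟩`. -/
def betti : Submodule A (M.Ext L) where
  carrier := {ω | M.toInv L ω = M.τExt L (M.pullExt L ω)}
  zero_mem' := by simp
  add_mem' {x y} hx hy := by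
    change _ = _ at hx hy ⊢
    rw [map_add, map_add, map_add, hx, hy]
  smul_mem' a x hx := by
    change _ = _ at hx ⊢
    have h : tensorFrob F A K (algebraMap A (A ⊗[F] K) a) = algebraMap A (A ⊗[F] K) a := by
      simp [tensorFrob, Algebra.TensorProduct.algebraMap_apply]
    rw [← algebraMap_smul (A ⊗[F] K) a x, map_smul, map_smulₛₗ, map_smul, hx, h]

theorem mem_betti {ω : M.Ext L} : ω ∈ M.betti L ↔ M.toInv L ω = M.τExt L (M.pullExt L ω) :=
  Iff.rfl

/-- `M` is rigid analytically trivial over `L` if multiplication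
`M_B ⊗_A L⟨A⟩ → M ⊗_{A ⊗ K} L⟨A⟩`, `ω ⊗ c ↦ c ω`, is bijective. -/
def IsRigidAnalyticallyTrivial : Prop :=
  Function.Bijective (LinearMap.liftBaseChange (Tate F A L) (M.betti L).subtype)

variable {M} {N : AMotive F A K} {L}

/-- The map `M ⊗ L⟨A⟩ → N ⊗ L⟨A⟩` induced by a morphism. -/
def extMap (L : Type u) [NormedField L] [Algebra F L] [Algebra K L] [IsScalarTower F K L]
    (f : M ⟶ N) : M.Ext L →ₗ[A ⊗[F] K] N.Ext L := LinearMap.lTensor (Tate F A L) f.lin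

theorem pullExt_tmul (s : Tate F A L) (m : M.carrier) :
    M.pullExt L (s ⊗ₜ m) = Tate.frob F A L s ⊗ₜ Pullback.mk (tensorFrob F A K) M.carrier m := rfl

theorem pullExt_extMap (f : M ⟶ N) (ω : M.Ext L) : N.pullExt L (extMap L f ω) =
    LinearMap.lTensor _ (Pullback.map (tensorFrob F A K) f.lin) (M.pullExt L ω) := by
  induction ω using TensorProduct.induction_on with
  | zero => simp
  | add x y hx hy => simp only [map_add, hx, hy]
  | tmul s m =>
    rw [extMap, LinearMap.lTensor_tmul, pullExt_tmul, pullExt_tmul, LinearMap.lTensor_tmul,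
      Pullback.map_mk]

theorem extMap_mem (f : M ⟶ N) {ω : M.Ext L} (hω : ω ∈ M.betti L) :
    extMap L f ω ∈ N.betti L := by
  rw [mem_betti] at hω ⊢
  have h1 : N.toInv L (extMap L f ω) =
      LinearMap.lTensor _ (InvAlong.map (idealJ F A K) f.lin) (M.toInv L ω) := by
    simp only [toInv, extMap, ← LinearMap.comp_apply, ← LinearMap.lTensor_comp]
    congr 2
    ext x
    exact congrArg Subtype.val (InvAlong.map_ι (idealJ F A K) f.lin x).symm
  have h3 (x) : N.τExt L (LinearMap.lTensor _ (Pullback.map (tensorFrob F A K) f.lin) x) =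
      LinearMap.lTensor _ (InvAlong.map (idealJ F A K) f.lin) (M.τExt L x) := by
    simp only [τExt, ← LinearMap.comp_apply, ← LinearMap.lTensor_comp]
    congr 2
    rw [← LinearMap.comp_assoc, f.comm, LinearMap.comp_assoc, LinearMap.comp_assoc]
    congr 1
    ext x
    exact congrArg Subtype.val (InvAlong.map_ι (idealJ F A K) _ x).symm
  rw [h1, pullExt_extMap, h3, hω]

/-- The map `f_B : M_B → N_B` induced by a morphism `f : M ⟶ N`. -/
def bettiMap (L : Type u) [NormedField L] [Algebra F L] [Algebra K L] [IsScalarTower F K L]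
    (f : M ⟶ N) : M.betti L →ₗ[A] N.betti L :=
  ((extMap L f).restrictScalars A).restrict fun _ hω => extMap_mem f hω

variable (M) {L' : Type u} [NormedField L'] [Algebra F L'] [Algebra K L'] [IsScalarTower F K L']

/-- The map `id ⊗ g : M ⊗ L⟨A⟩ → M ⊗ L'⟨A⟩` induced by a continuous `K`-morphism `g : L → L'`. -/
def mapExt (g : L →ₐ[K] L') (hg : Continuous g) : M.Ext L →ₗ[A ⊗[F] K] M.Ext L' :=
  LinearMap.rTensor M.carrier (Tate.mapAlg F A K g hg).toLinearMap

theorem mapExt_tmul (g : L →ₐ[K] L') (hg : Continuous g) (s : Tate F A L) (m : M.carrier) :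
    M.mapExt g hg (s ⊗ₜ m) = Tate.mapAlg F A K g hg s ⊗ₜ m := rfl

theorem pullExt_mapExt (g : L →ₐ[K] L') (hg : Continuous g) (ω : M.Ext L) :
    M.pullExt L' (M.mapExt g hg ω) =
      LinearMap.rTensor _ (Tate.mapAlg F A K g hg).toLinearMap (M.pullExt L ω) := by
  induction ω using TensorProduct.induction_on with
  | zero => simp
  | add x y hx hy => simp only [map_add, hx, hy]
  | tmul s m =>
    rw [mapExt_tmul, pullExt_tmul, pullExt_tmul, LinearMap.rTensor_tmul, ← Tate.mapAlg_frob]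
    rfl

theorem mapExt_mem (g : L →ₐ[K] L') (hg : Continuous g) {ω : M.Ext L} (hω : ω ∈ M.betti L) :
    M.mapExt g hg ω ∈ M.betti L' := by
  rw [mem_betti] at hω ⊢
  have h1 : M.toInv L' (M.mapExt g hg ω) =
      LinearMap.rTensor _ (Tate.mapAlg F A K g hg).toLinearMap (M.toInv L ω) := by
    simp only [toInv, mapExt, ← LinearMap.comp_apply, LinearMap.lTensor_comp_rTensor,
      LinearMap.rTensor_comp_lTensor]
  have h3 (x) : M.τExt L' (LinearMap.rTensor _ (Tate.mapAlg F A K g hg).toLinearMap x) =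
      LinearMap.rTensor _ (Tate.mapAlg F A K g hg).toLinearMap (M.τExt L x) := by
    simp only [τExt, ← LinearMap.comp_apply, LinearMap.lTensor_comp_rTensor,
      LinearMap.rTensor_comp_lTensor]
  rw [h1, pullExt_mapExt, h3, hω]

theorem extMap_mapExt (g : L →ₐ[K] L') (hg : Continuous g) (f : M ⟶ N) (ω : M.Ext L) :
    extMap L' f (M.mapExt g hg ω) = N.mapExt g hg (extMap L f ω) := by
  simp only [extMap, mapExt, ← LinearMap.comp_apply, LinearMap.lTensor_comp_rTensor,
    LinearMap.rTensor_comp_lTensor]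

theorem mapExt_eq_self (g : L →ₐ[K] L) (hg : Continuous g) (h : ∀ c, g c = c) (ω : M.Ext L) :
    M.mapExt g hg ω = ω := by
  have h1 : ∀ s, Tate.mapAlg F A K g hg s = s := fun s =>
    congrFun (Tate.hom_ext (Tate.continuous_mapAlg F A K g hg) continuous_id fun y => by
      induction y using TensorProduct.induction_on with
      | zero => simp
      | add x y hx hy => simp only [map_add, hx, hy, id]
      | tmul a c =>
        rw [Tate.mapAlg_toTate, Algebra.TensorProduct.map_tmul]
        exact congrArg (fun c => toTate F A L (a ⊗ₜ c)) (h c)) s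
  induction ω using TensorProduct.induction_on with
  | zero => simp
  | add x y hx hy => rw [map_add, hx, hy]
  | tmul s m => rw [mapExt_tmul, h1]

theorem mapExt_comp {L'' : Type u} [NormedField L''] [Algebra F L''] [Algebra K L'']
    [IsScalarTower F K L''] (g'' : L →ₐ[K] L'') (hg'' : Continuous g'') (g' : L' →ₐ[K] L'')
    (hg' : Continuous g') (g : L →ₐ[K] L') (hg : Continuous g) (h : ∀ c, g'' c = g' (g c))
    (ω : M.Ext L) : M.mapExt g'' hg'' ω = M.mapExt g' hg' (M.mapExt g hg ω) := by
  have h1 : ∀ s, Tate.mapAlg F A K g'' hg'' s =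
      Tate.mapAlg F A K g' hg' (Tate.mapAlg F A K g hg s) := fun s =>
    congrFun (Tate.hom_ext (g := Tate.mapAlg F A K g' hg' ∘ Tate.mapAlg F A K g hg)
      (Tate.continuous_mapAlg F A K g'' hg'')
      ((Tate.continuous_mapAlg F A K g' hg').comp (Tate.continuous_mapAlg F A K g hg)) fun y => by
      induction y using TensorProduct.induction_on with
      | zero => simp
      | add x y hx hy =>
        rw [map_add, map_add, hx, hy]
        simp only [Function.comp_apply, map_add]
      | tmul a c =>
        rw [Function.comp_apply, Tate.mapAlg_toTate, Tate.mapAlg_toTate, Tate.mapAlg_toTate,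
          Algebra.TensorProduct.map_tmul, Algebra.TensorProduct.map_tmul,
          Algebra.TensorProduct.map_tmul]
        exact congrArg (fun c => toTate F A L'' (a ⊗ₜ c)) (h c)) s
  induction ω using TensorProduct.induction_on with
  | zero => simp
  | add x y hx hy => rw [map_add, map_add, map_add, hx, hy]
  | tmul s m => rw [mapExt_tmul, mapExt_tmul, mapExt_tmul, h1]

/-- The map `M_B(L) → M_B(L')` induced by a continuous `K`-morphism `L → L'`. -/
def bettiChange (g : L →ₐ[K] L') (hg : Continuous g) : M.betti L →ₗ[A] M.betti L' :=
  ((M.mapExt g hg).restrictScalars A).restrict fun _ hω => M.mapExt_mem g hg hω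

end AMotive

end Betti

section Galois

variable {F K : Type u} [Field F] [Fintype F] [Field K] [Algebra F K] (P : ClosedPoint F K)

/-- `A`-motives over `K`, for `A` the ring of functions regular away from `P`. -/
abbrev AMotK : Type (u + 1) := AMotive F P.regularAway K

variable {P}

/-- The action of `G_∞` on the Betti realization, induced by `m ⊗ c ↦ m ⊗ σ(c)`. -/
def bettiRho (M : AMotK P) : Representation P.regularAway (Ginf P) (M.betti (Cinf P)) where
  toFun σ := M.bettiChange ((galCinf P σ).restrictScalars K) (continuous_galCinf P σ)
  map_one' := LinearMap.ext fun ω => Subtype.ext <|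
    AMotive.mapExt_eq_self M _ _ (fun c => galCinf_one P c) ω.1
  map_mul' σ σ' := LinearMap.ext fun ω => Subtype.ext <|
    AMotive.mapExt_comp M _ _ _ _ _ _ (fun c => galCinf_mul P σ σ' c) ω.1

theorem bettiRho_apply (M : AMotK P) (σ : Ginf P) (ω : M.betti (Cinf P)) :
    (bettiRho M σ ω : M.Ext (Cinf P)) =
      M.mapExt ((galCinf P σ).restrictScalars K) (continuous_galCinf P σ) ω := rfl

/-- The morphism of representations `M_B → N_B` induced by a morphism of `A`-motives. -/
def bettiHom {M N : AMotK P} (f : M ⟶ N) : (bettiRho M).IntertwiningMap (bettiRho N) where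
  toLinearMap := AMotive.bettiMap (Cinf P) f
  isIntertwining' σ := LinearMap.ext fun ω => Subtype.ext <|
    AMotive.extMap_mapExt M ((galCinf P σ).restrictScalars K) (continuous_galCinf P σ) f ω.1

variable (P)

/-- The Betti realization as a functor from `A`-motives over `K` to (abstract) `A`-linear
representations of `G_∞`. -/
def bettiFunctor : AMotK P ⥤ Rep.{u} P.regularAway (Ginf P) where
  obj M := Rep.of (bettiRho M)
  map f := Rep.ofHom (bettiHom f)
  map_id M := Rep.hom_ext <| Representation.IntertwiningMap.ext <|
    LinearMap.ext fun (ω : M.betti (Cinf P)) => Subtype.ext <|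
      LinearMap.congr_fun (LinearMap.lTensor_id _ _) ω.1
  map_comp {M _ _} f g := Rep.hom_ext <| Representation.IntertwiningMap.ext <|
    LinearMap.ext fun (ω : M.betti (Cinf P)) => Subtype.ext <|
      LinearMap.congr_fun (LinearMap.lTensor_comp _ g.lin f.lin) ω.1

/-- The full subcategory of rigid analytically trivial `A`-motives. -/
abbrev AMotRat : Type (u + 1) :=
  ObjectProperty.FullSubcategory fun M : AMotK P => M.IsRigidAnalyticallyTrivial (Cinf P)

/-- Representations `V` of a topological group on which the action `G × V → V` is continuous,
`V` being given the discrete topology. -/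
def IsContinuousRep (R G : Type u) [CommRing R] [Group G] [TopologicalSpace G] :
    ObjectProperty (Rep.{u} R G) := fun V =>
  letI : TopologicalSpace V := ⊥
  Continuous fun p : G × V => V.ρ p.1 p.2

/-- The category `Rep_A(G_∞)` of continuous `A`-linear representations of `G_∞`. -/
abbrev ContRep : Type (u + 1) := (IsContinuousRep P.regularAway (Ginf P)).FullSubcategory

end Galois

section Exactness

variable {F K : Type u} [Field F] [Fintype F] [Field K] [Algebra F K] {P : ClosedPoint F K}

/-- `0 → M' → M → M'' → 0` is exact in the category of rigid analytically trivial `A`-motives: the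
underlying sequence of modules is exact. -/
def AMotRat.IsShortExact {M' M M'' : AMotRat P} (f : M' ⟶ M) (g : M ⟶ M'') : Prop :=
  Function.Injective f.hom.lin ∧ Function.Exact f.hom.lin g.hom.lin ∧
    Function.Surjective g.hom.lin

/-- `0 → V' → V → V'' → 0` is exact in the category of continuous representations: the underlying
sequence of modules is exact. -/
def ContRep.IsShortExact {V' V V'' : ContRep P} (f : V' ⟶ V) (g : V ⟶ V'') : Prop :=
  Function.Injective f.hom.hom ∧ Function.Exact f.hom.hom g.hom.hom ∧
    Function.Surjective g.hom.hom

variable (P) in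
/-- The restriction of the Betti realization functor to rigid analytically trivial `A`-motives. -/
def bettiRat : AMotRat P ⥤ Rep.{u} P.regularAway (Ginf P) :=
  ObjectProperty.ι _ ⋙ bettiFunctor P

/-- The Betti realization functor with values in continuous representations, given that the
representations `M_B` are continuous. -/
def bettiCont (hcont : ∀ M : AMotRat P, IsContinuousRep _ _ ((bettiRat P).obj M)) :
    AMotRat P ⥤ ContRep P :=
  ObjectProperty.lift _ (bettiRat P) hcont

end Exactness

end AMot

end

open AMot

/-! Where `|a| > 1`, the element `a ⊗ 1 - 1 ⊗ a` of `𝔧` is inverted by a geometric series, so `𝔧`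
becomes the unit ideal in `L⟨A⟩` and `ω ↦ τ_M(τ^* ω)` is an operator on `M ⊗ L⟨A⟩`, given in
coordinates by `x ↦ Φ τ(x)`. As `τ` raises coefficients to the power `q`, this operator contracts
small balls. If `y` is close to a solution of `x = Φ τ(x)`, then its iterates therefore converge to
`x`, so that `x` is defined over every `L` over which `y` is; and `y` can be chosen over a finite
extension of `K_∞` in `K_∞^s`, which is dense in `ℂ_∞`. Since `A` is a direct summand of `ℂ_∞⟨A⟩`,
the `A`-module `M_B` is finitely generated, and one `L` suffices for all of it. An open subgroup of
`G_∞` fixes `L`, hence acts trivially on `M_B`.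

For exactness, `1 - τ` is surjective on `ℂ_∞⟨A⟩`: Artin–Schreier equations are solvable in `K_∞^s`,
and a small remainder is absorbed by the series `∑ τ^k`. Hence `1 - τ_M τ^*` is surjective on
`M ⊗ ℂ_∞⟨A⟩` if `M` is rigid analytically trivial, and the snake lemma applies. -/

noncomputable section

namespace AMot

section Poles

open IsDedekindDomain WithZero

theorem exists_valuation_lt_one_of_isSeparable (B K₀ : Type*) {E : Type*} [CommRing B]
    [IsDedekindDomain B] [Field K₀] [Field E] [Algebra B K₀] [IsFractionRing B K₀] [Algebra K₀ E]
    [Algebra B E] [IsScalarTower B K₀ E] [FiniteDimensional K₀ E] [Algebra.IsSeparable K₀ E]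
    {b : B} (hb₀ : b ≠ 0) (hb : ¬ IsUnit b) :
    ∃ v : Valuation E ℤᵐ⁰, v (algebraMap B E b) < 1 ∧ ∀ x : B, v (algebraMap B E x) ≤ 1 := by
  let O := integralClosure B E
  have : IsDedekindDomain O := integralClosure.isDedekindDomain B K₀ E
  have : IsFractionRing O E := IsIntegralClosure.isFractionRing_of_finite_extension B K₀ E _
  have hBE : Function.Injective (algebraMap B E) := by
    rw [IsScalarTower.algebraMap_eq B K₀ E]
    exact (algebraMap K₀ E).injective.comp (IsFractionRing.injective B K₀)
  have hBO : Function.Injective (algebraMap B O) := .of_comp (f := algebraMap O E) hBE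
  have : FaithfulSMul B O := (faithfulSMul_iff_algebraMap_injective B O).2 hBO
  obtain ⟨n, hn, hbn⟩ := exists_max_ideal_of_mem_nonunits hb
  obtain ⟨m, hm, hmn⟩ := Ideal.exists_maximal_ideal_liesOver_of_isIntegral (S := O) n
  have hbm : algebraMap B O b ∈ m := by rwa [← Ideal.mem_comap, ← Ideal.under_def, ← hmn.over]
  have hm₀ : m ≠ ⊥ := by
    rintro rfl
    exact hb₀ ((map_eq_zero_iff _ hBO).1 hbm)
  let v : HeightOneSpectrum O := ⟨m, hm.isPrime, hm₀⟩
  exact ⟨v.valuation E, (v.valuation_lt_one_iff_mem (K := E) (algebraMap B O b)).2 hbm,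
    fun x => v.valuation_le_one (K := E) (algebraMap B O x)⟩

theorem exists_valuation_lt_one (B K₀ : Type*) {E : Type*} [CommRing B]
    [IsDedekindDomain B] [Field K₀] [Field E] [Algebra B K₀] [IsFractionRing B K₀] [Algebra K₀ E]
    [Algebra B E] [IsScalarTower B K₀ E] [FiniteDimensional K₀ E]
    {b : B} (hb₀ : b ≠ 0) (hb : ¬ IsUnit b) :
    ∃ v : Valuation E ℤᵐ⁰, v (algebraMap B E b) < 1 ∧ ∀ x : B, v (algebraMap B E x) ≤ 1 := by
  let S := separableClosure K₀ E
  have : FiniteDimensional S E := Module.Finite.of_restrictScalars_finite K₀ S E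
  let : Algebra B S := ((algebraMap K₀ S).comp (algebraMap B K₀)).toAlgebra
  have : IsScalarTower B K₀ S := .of_algebraMap_eq fun _ => rfl
  obtain ⟨v, hvb, hvB⟩ := exists_valuation_lt_one_of_isSeparable B K₀ (E := S) hb₀ hb
  obtain ⟨p, hp⟩ := ExpChar.exists S
  -- A power of Frobenius maps `E` to `S`, and the valuation is pulled back along it.
  let φ : E →+* S := IsPurelyInseparable.iterateFrobenius S E p le_rfl
  have hφ (x : B) :
      φ (algebraMap B E x) = algebraMap B S x ^ p ^ IsPurelyInseparable.exponent S E := by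
    rw [IsScalarTower.algebraMap_apply B K₀ E]
    exact IsPurelyInseparable.iterateFrobenius_algebraMap E p le_rfl (algebraMap B S x)
  refine ⟨v.comap φ, ?_, fun x => ?_⟩
  · rw [Valuation.comap_apply, hφ, map_pow]
    exact pow_lt_one₀ zero_le hvb (pow_ne_zero _ (expChar_pos S p).ne')
  · rw [Valuation.comap_apply, hφ, map_pow]
    exact pow_le_one₀ zero_le (hvB x)

theorem isDiscreteValuationRing_valuationSubring {K : Type*} [Field K] (v : Valuation K ℤᵐ⁰)
    [v.IsNontrivial] : IsDiscreteValuationRing v.valuationSubring := by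
  have : IsCyclic ℤᵐ⁰ˣ :=
    isCyclic_of_surjective (WithZero.unitsWithZeroEquiv (α := Multiplicative ℤ)).symm
      (MulEquiv.surjective _)
  infer_instance

variable {F K : Type u} [Field F] [Field K] [Algebra F K] [IsCurveFunctionField F K]

theorem finiteDimensional_adjoin_of_transcendental {b : K} (hb : Transcendental F b) :
    FiniteDimensional (IntermediateField.adjoin F {b}) K := by
  have : Algebra.EssFiniteType F K :=
    IntermediateField.fg_top_iff.1 (IsCurveFunctionField.fg (F := F) (K := K))
  have : Algebra.EssFiniteType (IntermediateField.adjoin F {b}) K :=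
    Algebra.EssFiniteType.of_comp F _ K
  have hb' : IsTranscendenceBasis F (fun _ : Unit => b) :=
    (algebraicIndependent_unique_type_iff.2 hb).isTranscendenceBasis_of_lift_trdeg_le_of_finite
      (by simp [IsCurveFunctionField.trdeg_eq_one (F := F) (K := K)])
  have : Algebra.IsAlgebraic (IntermediateField.adjoin F {b}) K := by
    rw [← Set.range_const (ι := Unit) (c := b)]
    exact hb'.isAlgebraic_field
  exact Algebra.finite_of_essFiniteType_of_isAlgebraic

open scoped IntermediateField.algebraAdjoinAdjoin in
theorem exists_valuation_one_lt {a : K} (ha : Transcendental F a) :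
    ∃ v : Valuation K ℤᵐ⁰, 1 < v a ∧ ∀ c : F, v (algebraMap F K c) ≤ 1 := by
  have hb : Transcendental F a⁻¹ := fun h => ha (by simpa only [inv_inv] using h.inv)
  have := finiteDimensional_adjoin_of_transcendental hb
  let e := Polynomial.algEquivOfTranscendental F a⁻¹ hb
  have heX : e Polynomial.X = ⟨a⁻¹, Algebra.self_mem_adjoin_singleton F a⁻¹⟩ :=
    Polynomial.algEquivOfTranscendental_apply_X F a⁻¹ hb
  have : IsPrincipalIdealRing (Algebra.adjoin F {a⁻¹}) :=
    IsPrincipalIdealRing.of_surjective e e.surjective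
  obtain ⟨v, hv, hv'⟩ := exists_valuation_lt_one (Algebra.adjoin F {a⁻¹})
    (IntermediateField.adjoin F {a⁻¹}) (E := K) (b := e Polynomial.X)
    (by simpa only [ne_eq, EmbeddingLike.map_eq_zero_iff] using Polynomial.X_ne_zero)
    (by simpa only [MulEquiv.isUnit_map] using Polynomial.not_isUnit_X)
  have hva : v a⁻¹ < 1 := by rwa [heX] at hv
  have ha₀ : a ≠ 0 := by
    rintro rfl
    exact ha isAlgebraic_zero
  rw [map_inv₀, inv_lt_one₀ (zero_lt_iff.2 ((Valuation.ne_zero_iff v).2 ha₀))] at hva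
  exact ⟨v, hva, fun c => hv' (algebraMap F _ c)⟩

theorem exists_closedPoint_notMem {a : K} (ha : Transcendental F a) :
    ∃ Q : ClosedPoint F K, a ∉ Q.localRing := by
  obtain ⟨v, hva, hvF⟩ := exists_valuation_one_lt ha
  have : v.IsNontrivial := ⟨a, (zero_lt_one.trans hva).ne', hva.ne'⟩
  exact ⟨⟨v.valuationSubring, hvF, isDiscreteValuationRing_valuationSubring v⟩, hva.not_ge⟩

variable (P : ClosedPoint F K)

theorem ClosedPoint.mem_range_algebraMap {a : K} (ha : a ∈ P.regularAway)
    (haP : a ∈ P.localRing) : a ∈ (algebraMap F K).range := by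
  refine IsCurveFunctionField.constants a (isAlgebraic_iff_isIntegral.1 ?_)
  by_contra ha'
  obtain ⟨Q, hQ⟩ := exists_closedPoint_notMem ha'
  obtain rfl | hne := eq_or_ne Q P
  exacts [hQ haP, hQ (ha Q hne)]

end Poles

theorem ClosedPoint.one_lt_abv {F K : Type u} [Field F] [Fintype F] [Field K] [Algebra F K]
    (P : ClosedPoint F K) {a : K} (ha : a ∉ P.localRing) : 1 < P.abv a := by
  have := P.isDVR
  have ha₀ : a ≠ 0 := fun h => ha (h ▸ zero_mem _)
  have hinv : a⁻¹ ∈ P.localRing := (P.localRing.mem_or_inv_mem a).resolve_left ha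
  have hmem : (⟨a⁻¹, hinv⟩ : P.localRing) ∈ IsLocalRing.maximalIdeal P.localRing := by
    rw [P.localRing.valuation_lt_one_iff, map_inv₀]
    exact inv_lt_one_of_one_lt₀ (not_le.1 (mt (P.localRing.valuation_le_one_iff a).1 ha))
  have hlt : P.abv a⁻¹ < 1 :=
    (IsDedekindDomain.HeightOneSpectrum.adicAbv_coe_lt_one_iff (K := K) _ _
      (⟨a⁻¹, hinv⟩ : P.localRing)).2 hmem
  rwa [map_inv₀, inv_lt_one₀ (P.abv.pos ha₀)] at hlt

section Iterates

open Filter Topology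

theorem tendsto_iterate_nhds {X : Type*} [TopologicalSpace X] {x₀ : X}
    {U : {r : ℝ // 0 < r} → Set X}
    (hU : (𝓝 x₀).HasBasis (fun _ => True) U) (hmono : Monotone U) {f : X → X}
    {c r : {r : ℝ // 0 < r}} (hc : (c : ℝ) < 1)
    (hf : ∀ s ≤ r, Set.MapsTo f (U s) (U (c * s))) {x : X} (hx : x ∈ U r) :
    Tendsto (fun k => f^[k] x) atTop (𝓝 x₀) := by
  have hle (k : ℕ) : c ^ k * r ≤ r :=
    show (c : ℝ) ^ k * r ≤ r from mul_le_of_le_one_left r.2.le (pow_le_one₀ c.2.le hc.le)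
  have hmem (k : ℕ) : f^[k] x ∈ U (c ^ k * r) := by
    induction k with
    | zero => simpa using hx
    | succ k ih =>
      rw [Function.iterate_succ_apply', pow_succ', mul_assoc]
      exact hf _ (hle k) ih
  have hlim : Tendsto (fun k : ℕ => (c : ℝ) ^ k * r) atTop (𝓝 0) := by
    simpa using (tendsto_pow_atTop_nhds_zero_of_lt_one c.2.le hc).mul_const (r : ℝ)
  refine hU.tendsto_right_iff.2 fun s _ => ?_
  filter_upwards [hlim.eventually_le_const s.2] with k hk
  exact hmono (show c ^ k * r ≤ s from hk) (hmem k)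

theorem exists_sub_map_eq_of_tendsto_iterate {G : Type*} [AddCommGroup G] [UniformSpace G]
    [IsUniformAddGroup G] [NonarchimedeanAddGroup G] [CompleteSpace G] [T2Space G] {f : G →+ G}
    (hf : Continuous f) {y : G} (hy : Tendsto (fun k => f^[k] y) atTop (𝓝 0)) :
    ∃ x, x - f x = y := by
  have hsum : Summable fun k => f^[k] y :=
    NonarchimedeanAddGroup.summable_of_tendsto_cofinite_zero (Nat.cofinite_eq_atTop ▸ hy)
  refine ⟨∑' k, f^[k] y, ?_⟩
  have hshift : f (∑' k, f^[k] y) = ∑' k, f^[k + 1] y := by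
    simp only [hsum.map_tsum f hf, Function.iterate_succ_apply']
  rw [hshift, hsum.tsum_eq_zero_add, add_sub_cancel_right, Function.iterate_zero_apply]

theorem mem_of_tendsto_iterate_sub {G : Type*} [AddCommGroup G] [TopologicalSpace G]
    [IsTopologicalAddGroup G] {S : AddSubgroup G} (hS : IsClosed (S : Set G)) {f : G →+ G}
    (hfS : Set.MapsTo f S S) {x y : G} (hx : f x = x) (hy : y ∈ S)
    (hxy : Tendsto (fun k => f^[k] (x - y)) atTop (𝓝 0)) : x ∈ S := by
  have hiter (k : ℕ) : f^[k] y = x - f^[k] (x - y) := by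
    rw [iterate_map_sub, Function.iterate_fixed hx, sub_sub_cancel]
  have hlim : Tendsto (fun k => f^[k] y) atTop (𝓝 x) := by
    simpa only [hiter, sub_zero] using tendsto_const_nhds.sub hxy
  exact hS.mem_of_tendsto hlim (.of_forall fun k => hfS.iterate k hy)

end Iterates

section TateTopology

open Topology UniformSpace

variable (F A L : Type u) [Field F] [CommRing A] [Algebra F A] [NormedField L] [Algebra F L]

instance : NonarchimedeanRing (PreTate F A L) := (PreTate.ringSubgroupsBasis F A L).nonarchimedean

instance : IsTopologicalRing (Tate F A L) :=
  inferInstanceAs (IsTopologicalRing (Completion (PreTate F A L)))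

instance : IsUniformAddGroup (Tate F A L) :=
  inferInstanceAs (IsUniformAddGroup (Completion (PreTate F A L)))

instance : CompleteSpace (Tate F A L) :=
  inferInstanceAs (CompleteSpace (Completion (PreTate F A L)))

instance : NonarchimedeanRing (Tate F A L) :=
  inferInstanceAs (NonarchimedeanRing (Completion (PreTate F A L)))

/-- The closure in `L⟨A⟩` of the image of `A ⊗ {c | ‖c‖ ≤ r}`. -/
def Tate.ball (r : {r : ℝ // 0 < r}) : AddSubgroup (Tate F A L) :=
  AddSubgroup.topologicalClosure
    ((PreTate.ball F A L r).map (Completion.toCompl : PreTate F A L →+ _))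

variable {F A L} {r s t : {r : ℝ // 0 < r}}

theorem Tate.toTate_mem_ball {x : A ⊗[F] L} (hx : PreTate.of F A L x ∈ PreTate.ball F A L r) :
    toTate F A L x ∈ Tate.ball F A L r :=
  AddSubgroup.le_topologicalClosure _ ⟨_, hx, rfl⟩

theorem Tate.toTate_tmul_mem_ball (a : A) {c : L} (hc : ‖c‖ ≤ r) :
    toTate F A L (a ⊗ₜ c) ∈ Tate.ball F A L r :=
  Tate.toTate_mem_ball (PreTate.tmul_mem_ball a hc)

theorem Tate.ball_mono : Monotone (Tate.ball F A L) := fun _ _ h =>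
  AddSubgroup.topologicalClosure_mono (AddSubgroup.map_mono (PreTate.ball_mono F A L h))

theorem Tate.ball_mem_nhds (r : {r : ℝ // 0 < r}) :
    (Tate.ball F A L r : Set (Tate F A L)) ∈ 𝓝 0 :=
  (Completion.isDenseInducing_coe (α := PreTate F A L)).closure_image_mem_nhds
    ((PreTate.ringSubgroupsBasis F A L).hasBasis_nhds_zero.mem_of_mem trivial)

theorem Tate.hasBasis_nhds_zero : (𝓝 (0 : Tate F A L)).HasBasis (fun _ => True)
    fun r => (Tate.ball F A L r : Set (Tate F A L)) := by
  refine ⟨fun U => ⟨fun hU => ?_, fun ⟨r, _, hr⟩ =>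
    Filter.mem_of_superset (Tate.ball_mem_nhds r) hr⟩⟩
  obtain ⟨C, ⟨hC, hCclosed⟩, hCU⟩ := (closed_nhds_basis (0 : Tate F A L)).mem_iff.1 hU
  have hpre : ((↑) : PreTate F A L → Completion (PreTate F A L)) ⁻¹' C ∈ 𝓝 0 :=
    (Completion.continuous_coe _).continuousAt.preimage_mem_nhds hC
  obtain ⟨r, -, hr⟩ := (PreTate.ringSubgroupsBasis F A L).hasBasis_nhds_zero.mem_iff.1 hpre
  exact ⟨r, trivial, (closure_minimal (Set.image_subset_iff.2 hr) hCclosed).trans hCU⟩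

theorem Tate.mul_mem_ball (h : (r : ℝ) * s ≤ t) {x y : Tate F A L}
    (hx : x ∈ Tate.ball F A L r) (hy : y ∈ Tate.ball F A L s) : x * y ∈ Tate.ball F A L t := by
  refine map_mem_closure₂ (f := fun x y : Tate F A L => x * y) continuous_mul hx hy ?_
  rintro _ ⟨x, hx, rfl⟩ _ ⟨y, hy, rfl⟩
  exact ⟨x * y, PreTate.ball_mul F A L h hx hy, Completion.coe_mul x y⟩

theorem Tate.exists_sub_toTate_mem_ball (x : Tate F A L) (r : {r : ℝ // 0 < r}) :
    ∃ y : A ⊗[F] L, x - toTate F A L y ∈ Tate.ball F A L r := by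
  have h : (fun z => x - z) ⁻¹' (Tate.ball F A L r : Set (Tate F A L)) ∈ 𝓝 x :=
    (continuous_sub_left x).continuousAt.preimage_mem_nhds (by
      simpa only [sub_self] using Tate.ball_mem_nhds (F := F) (A := A) (L := L) r)
  exact (denseRange_toTate F A L).mem_nhds h

theorem Tate.exists_mem_ball (x : Tate F A L) : ∃ r, x ∈ Tate.ball F A L r := by
  obtain ⟨y, hy⟩ := Tate.exists_sub_toTate_mem_ball x 1
  obtain ⟨s, hs⟩ := PreTate.exists_mem_ball F A L (PreTate.of F A L y)
  refine ⟨1 ⊔ s, ?_⟩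
  rw [← sub_add_cancel x (toTate F A L y)]
  exact add_mem (Tate.ball_mono le_sup_left hy)
    (Tate.ball_mono le_sup_right (Tate.toTate_mem_ball hs))

theorem Tate.exists_forall_mem_ball {ι : Type*} [Finite ι] (x : ι → Tate F A L) :
    ∃ r, ∀ i, x i ∈ Tate.ball F A L r := by
  choose r hr using fun i => Tate.exists_mem_ball (x i)
  obtain ⟨s, hs⟩ := Finite.exists_le r
  exact ⟨s, fun i => Tate.ball_mono (hs i) (hr i)⟩

theorem Tate.isUnit_one_sub (hr : (r : ℝ) < 1) {x : Tate F A L} (hx : x ∈ Tate.ball F A L r) :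
    IsUnit (1 - x) := by
  obtain ⟨s, hs⟩ := Tate.exists_mem_ball (1 : Tate F A L)
  obtain ⟨y, hy⟩ := exists_sub_map_eq_of_tendsto_iterate (f := AddMonoidHom.mulLeft x)
    (continuous_const_mul x) (tendsto_iterate_nhds Tate.hasBasis_nhds_zero Tate.ball_mono hr
      (fun t _ z hz => Tate.mul_mem_ball (t := r * t) le_rfl hx hz) hs)
  exact .of_mul_eq_one y (by rw [sub_mul, one_mul]; exact hy)

variable {L' : Type u} [NormedField L'] [Algebra F L']

theorem Tate.exists_sub_toTate_map_mem_ball {g : L →ₐ[F] L'} (hg : DenseRange g)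
    (x : Tate F A L') (r : {r : ℝ // 0 < r}) : ∃ y : A ⊗[F] L,
      x - toTate F A L' (Algebra.TensorProduct.map (.id F A) g y) ∈ Tate.ball F A L' r := by
  obtain ⟨z, hz⟩ := Tate.exists_sub_toTate_mem_ball x r
  suffices ∃ y : A ⊗[F] L,
      toTate F A L' (z - Algebra.TensorProduct.map (.id F A) g y) ∈ Tate.ball F A L' r by
    obtain ⟨y, hy⟩ := this
    exact ⟨y, by simpa only [map_sub, sub_add_sub_cancel] using add_mem hz hy⟩
  clear hz
  induction z using TensorProduct.induction_on with
  | zero => exact ⟨0, by simp⟩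
  | add z z' h h' =>
    obtain ⟨y, hy⟩ := h
    obtain ⟨y', hy'⟩ := h'
    exact ⟨y + y', by simpa only [map_add, map_sub, add_sub_add_comm] using add_mem hy hy'⟩
  | tmul a c =>
    obtain ⟨d, hd⟩ := hg.exists_dist_lt c r.2
    refine ⟨a ⊗ₜ d, ?_⟩
    rw [Algebra.TensorProduct.map_tmul, AlgHom.id_apply, ← TensorProduct.tmul_sub]
    exact Tate.toTate_tmul_mem_ball a (dist_eq_norm c (g d) ▸ hd.le)

section Frobenius

variable [Fintype F]

theorem Tate.frob_mem_ball (h : (r : ℝ) ^ Fintype.card F ≤ s)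
    {x : Tate F A L} (hx : x ∈ Tate.ball F A L r) : Tate.frob F A L x ∈ Tate.ball F A L s := by
  refine map_mem_closure (Tate.continuous_frob F A L) hx ?_
  rintro _ ⟨x, hx, rfl⟩
  refine ⟨PreTate.map F A (FiniteField.frobeniusAlgHom F L) x, ?_,
    (Completion.mapRingHom_coe (PreTate.continuous_map F A _ (continuous_frobeniusAlgHom L))
      x).symm⟩
  induction hx using AddSubgroup.closure_induction with
  | zero => rw [map_zero]; exact zero_mem _
  | add x y _ _ h1 h2 => rw [map_add]; exact add_mem h1 h2
  | neg x _ h1 => rw [map_neg]; exact neg_mem h1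
  | mem x hx =>
    obtain ⟨a, c, hc, rfl⟩ := hx
    rw [PreTate.map_of, Algebra.TensorProduct.map_tmul]
    refine PreTate.tmul_mem_ball _ ?_
    rw [FiniteField.coe_frobeniusAlgHom, norm_pow]
    exact (pow_le_pow_left₀ (norm_nonneg _) hc _).trans h

theorem Tate.exists_sub_frob_eq_of_mem_ball (hr : (r : ℝ) < 1) {x : Tate F A L}
    (hx : x ∈ Tate.ball F A L r) : ∃ y, y - Tate.frob F A L y = x := by
  refine exists_sub_map_eq_of_tendsto_iterate (f := (Tate.frob F A L).toAddMonoidHom)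
    (Tate.continuous_frob F A L) (tendsto_iterate_nhds Tate.hasBasis_nhds_zero Tate.ball_mono hr
      (fun s hs z hz => Tate.frob_mem_ball ?_ hz) hx)
  calc (s : ℝ) ^ Fintype.card F ≤ (s : ℝ) ^ 2 :=
        pow_le_pow_of_le_one s.2.le (le_trans hs hr.le) Fintype.one_lt_card
    _ = s * s := sq _
    _ ≤ r * s := mul_le_mul_of_nonneg_right hs s.2.le

end Frobenius

section NormPreserving

variable [Finite F]

theorem norm_smul_le_of_finite (f : F) (c : L) : ‖f • c‖ ≤ ‖c‖ := by
  obtain rfl | hf := eq_or_ne f 0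
  · rw [zero_smul, norm_zero]
    exact norm_nonneg c
  · have hfin : IsOfFinOrder (algebraMap F L f) :=
      MonoidHom.isOfFinOrder (algebraMap F L : F →* L)
        (Units.isOfFinOrder_val.2 (isOfFinOrder_of_finite (Units.mk0 f hf)))
    rw [Algebra.smul_def, norm_mul, hfin.norm_eq_one, one_mul]

variable [IsUltrametricDist L] [IsUltrametricDist L']

theorem PreTate.mem_ball_iff {ι : Type*} [DecidableEq ι] (e : Module.Basis ι F A)
    (r : {r : ℝ // 0 < r}) (x : A ⊗[F] L) : PreTate.of F A L x ∈ PreTate.ball F A L r ↔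
      ∀ i, ‖TensorProduct.equivFinsuppOfBasisLeft e x i‖ ≤ r := by
  refine ⟨fun hx i => ?_, fun h => ?_⟩
  · rw [← (PreTate.of F A L).symm_apply_apply x]
    generalize PreTate.of F A L x = x at hx
    induction hx using AddSubgroup.closure_induction with
    | zero => simp [r.2.le]
    | add x y _ _ hx hy =>
      rw [map_add, map_add, Finsupp.add_apply]
      exact (IsUltrametricDist.norm_add_le_max _ _).trans (max_le hx hy)
    | neg x _ hx => rwa [map_neg, map_neg, Finsupp.neg_apply, norm_neg]
    | mem x hx =>
      obtain ⟨a, c, hc, rfl⟩ := hx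
      rw [RingEquiv.symm_apply_apply, TensorProduct.equivFinsuppOfBasisLeft_apply_tmul_apply]
      exact (norm_smul_le_of_finite _ _).trans hc
  · rw [← (TensorProduct.equivFinsuppOfBasisLeft (N := L) e).symm_apply_apply x,
      TensorProduct.equivFinsuppOfBasisLeft_symm_apply, Finsupp.sum, map_sum]
    exact sum_mem fun i _ => PreTate.tmul_mem_ball _ (h i)

theorem PreTate.map_mem_ball_iff {g : L →ₐ[F] L'} (hg : ∀ c, ‖g c‖ = ‖c‖) (x : PreTate F A L) :
    PreTate.map F A g x ∈ PreTate.ball F A L' r ↔ x ∈ PreTate.ball F A L r := by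
  classical
  obtain ⟨x, rfl⟩ := (PreTate.of F A L).surjective x
  let e := Module.Basis.ofVectorSpace F A
  have hcoord (i) : TensorProduct.equivFinsuppOfBasisLeft e
      (Algebra.TensorProduct.map (AlgHom.id F A) g x) i =
        g (TensorProduct.equivFinsuppOfBasisLeft e x i) := by
    induction x using TensorProduct.induction_on with
    | zero => simp only [map_zero, Finsupp.zero_apply]
    | add x y hx hy => simp only [map_add, Finsupp.add_apply, hx, hy]
    | tmul a c => simp
  simp only [PreTate.map_of, PreTate.mem_ball_iff e, hcoord, hg]

theorem PreTate.isUniformInducing_map {g : L →ₐ[F] L'} (hg : ∀ c, ‖g c‖ = ‖c‖) :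
    IsUniformInducing (PreTate.map F A g) := by
  refine AddMonoidHom.isUniformInducing_of_isInducing (f := PreTate.map F A g) ?_
  rw [IsTopologicalAddGroup.isInducing_iff_nhds_zero]
  refine (PreTate.ringSubgroupsBasis F A L).hasBasis_nhds_zero.eq_of_same_basis ?_
  refine ((PreTate.ringSubgroupsBasis F A L').hasBasis_nhds_zero.comap (PreTate.map F A g)).congr
    (fun _ => Iff.rfl) fun r _ => Set.ext fun x => PreTate.map_mem_ball_iff hg x

theorem Tate.isClosed_range_mapAlg {K : Type u} [Field K] [Algebra F K] [Algebra K L]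
    [IsScalarTower F K L] [Algebra K L'] [IsScalarTower F K L'] {g : L →ₐ[K] L'}
    (hg : ∀ c, ‖g c‖ = ‖c‖) (hc : Continuous g) :
    IsClosed ((Tate.mapAlg F A K g hc).range : Set (Tate F A L')) := by
  have hinducing : IsUniformInducing (Tate.map F A (g.restrictScalars F) hc) :=
    Completion.isUniformInducing_extension
      ((Completion.isUniformInducing_coe _).comp (PreTate.isUniformInducing_map hg))
  exact hinducing.isComplete_range.isClosed

end NormPreserving

end TateTopology

section Localization

variable {R M M' T : Type*} [CommRing R] [AddCommGroup M] [Module R M] [AddCommGroup M']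
  [Module R M'] [CommRing T] [Algebra R T] {f : M →ₗ[R] M'} {u : R}

theorem isLocalizedModule_id_of_isUnit {S : Submonoid R}
    (hS : ∀ s : S, IsUnit (algebraMap R (Module.End R M) s)) :
    IsLocalizedModule S (LinearMap.id : M →ₗ[R] M) :=
  ⟨hS, fun x => ⟨(x, 1), one_smul S x⟩, fun h => ⟨1, congrArg _ h⟩⟩

theorem bijective_of_isLocalizedModule (S : Submonoid R) (f : M →ₗ[R] M') [IsLocalizedModule S f]
    (hS : ∀ s : S, IsUnit (algebraMap R (Module.End R M) s)) : Function.Bijective f := by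
  have := isLocalizedModule_id_of_isUnit hS
  have hf : ⇑f = IsLocalizedModule.linearEquiv S LinearMap.id f := funext fun x =>
    (IsLocalizedModule.linearEquiv_apply S LinearMap.id f x).symm
  exact hf ▸ LinearEquiv.bijective _

theorem bijective_lTensor_of_isLocalizedModule (S : Submonoid R) (f : M →ₗ[R] M')
    [IsLocalizedModule S f] (hS : ∀ s : S, IsUnit (algebraMap R T s)) :
    Function.Bijective (LinearMap.lTensor T f) := by
  have hS' (s : S) : IsUnit (algebraMap R (Module.End R (T ⊗[R] M)) s) := by
    simpa only [AlgHom.commutes] using (hS s).map (Algebra.lsmul R R (T ⊗[R] M))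
  have := isLocalizedModule_id_of_isUnit (M := T) (S := S) fun s => by
    simpa only [AlgHom.commutes] using (hS s).map (Algebra.lsmul R R T)
  exact bijective_of_isLocalizedModule S (TensorProduct.map LinearMap.id f) hS'

theorem isLocalizedModule_powers_comp (hf : Function.Injective f)
    (hu : ∀ y, ∃ n : ℕ, u ^ n • y ∈ LinearMap.range f) :
    IsLocalizedModule (.powers u) (LocalizedModule.mkLinearMap (.powers u) M' ∘ₗ f) where
  map_units := IsLocalizedModule.map_units (LocalizedModule.mkLinearMap (.powers u) M')
  surj z := by
    obtain ⟨⟨y, s⟩, hy⟩ := IsLocalizedModule.surj (.powers u) (LocalizedModule.mkLinearMap _ M') z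
    obtain ⟨n, x, hx⟩ := hu y
    refine ⟨(x, ⟨u ^ n, n, rfl⟩ * s), ?_⟩
    rw [LinearMap.comp_apply, hx, map_smul, ← hy, mul_smul]
    rfl
  exists_of_eq h := by
    obtain ⟨c, hc⟩ := (IsLocalizedModule.eq_iff_exists (.powers u)
      (LocalizedModule.mkLinearMap (.powers u) M')).1 h
    exact ⟨c, hf (by simpa only [Submonoid.smul_def, map_smul] using hc)⟩

theorem bijective_lTensor_of_forall_pow_smul_mem_range (hu : IsUnit (algebraMap R T u))
    (hf : Function.Injective f) (h : ∀ y, ∃ n : ℕ, u ^ n • y ∈ LinearMap.range f) :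
    Function.Bijective (LinearMap.lTensor T f) := by
  have := isLocalizedModule_powers_comp hf h
  have hS (s : Submonoid.powers u) : IsUnit (algebraMap R T s) := by
    obtain ⟨_, n, rfl⟩ := s
    simpa only [map_pow] using hu.pow n
  let p := LocalizedModule.mkLinearMap (.powers u) M'
  have hp := bijective_lTensor_of_isLocalizedModule (T := T) _ p hS
  have hpf := bijective_lTensor_of_isLocalizedModule (T := T) _ (p ∘ₗ f) hS
  rw [LinearMap.lTensor_comp, LinearMap.coe_comp] at hpf
  exact (Function.Bijective.of_comp_iff' hp _).1 hpf

end Localization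

section PolesAlong

variable {R : Type u} [CommRing R]

theorem InvAlong.ι_injective (j : Ideal R) {N : Type u} [AddCommGroup N] [Module R N]
    [Module.Flat R N] : Function.Injective (InvAlong.ι j N) := by
  have hreg : Function.Injective (LocalizedModule.mkLinearMap R⁰ N) :=
    (IsLocalizedModule.injective_iff_isRegular R⁰ _).2
      fun c => Module.Flat.isSMulRegular_of_nonZeroDivisors c.2
  exact fun x y h => hreg (congrArg Subtype.val h)

/-- `u` clears poles along `j` if `N[j⁻¹] ⊆ N[u⁻¹]` for every `R`-module `N`. -/
def ClearsPoles (j : Ideal R) (u : R) : Prop :=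
  ∀ (N : Type u) [AddCommGroup N] [Module R N] (z : InvAlong j N),
    ∃ n : ℕ, u ^ n • z ∈ LinearMap.range (InvAlong.ι j N)

theorem clearsPoles_of_mem {j : Ideal R} {u : R} (hu : u ∈ j) : ClearsPoles j u := by
  intro N _ _ z
  obtain ⟨n, hn⟩ := z.2
  obtain ⟨m, hm⟩ := hn _ (Ideal.pow_mem_pow hu n)
  exact ⟨n, m, Subtype.ext hm⟩

theorem clearsPoles_of_forall_isUnit (hR : ∀ s ∈ R⁰, IsUnit s) (j : Ideal R) (u : R) :
    ClearsPoles j u := by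
  intro N _ _ z
  obtain ⟨m, hm⟩ := (bijective_of_isLocalizedModule R⁰ (LocalizedModule.mkLinearMap R⁰ N)
    fun s => (hR s s.2).map _).2 z.1
  exact ⟨0, m, Subtype.ext (by rw [pow_zero, one_smul]; exact hm)⟩

end PolesAlong

section Tate

open Tate

variable {F A K L : Type u} [Field F] [CommRing A] [Algebra F A] [Field K] [Algebra F K]
  [Algebra A K] [NormedField L] [Algebra F L] [Algebra K L] [IsScalarTower F K L]

theorem isUnit_algebraMap_tmul_one_sub_one_tmul {a : A}
    (ha : 1 < ‖algebraMap K L (algebraMap A K a)‖) : IsUnit (algebraMap (A ⊗[F] K) (Tate F A L)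
      (a ⊗ₜ 1 - 1 ⊗ₜ algebraMap A K a)) := by
  set α := algebraMap K L (algebraMap A K a) with hα
  have hα₀ : α ≠ 0 := norm_pos_iff.1 (one_pos.trans ha)
  have hinv : ‖α⁻¹‖ < 1 := by rw [norm_inv]; exact inv_lt_one_of_one_lt₀ ha
  have hunit : IsUnit (1 - toTate F A L (a ⊗ₜ α⁻¹)) :=
    isUnit_one_sub (r := ⟨‖α⁻¹‖, norm_pos_iff.2 (inv_ne_zero hα₀)⟩) hinv
      (toTate_tmul_mem_ball a le_rfl)
  have hone : IsUnit (toTate F A L (1 ⊗ₜ α)) :=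
    ((IsUnit.mk0 α hα₀).map (Algebra.TensorProduct.includeRight : L →ₐ[F] A ⊗[F] L)).map _
  convert (hone.mul hunit).neg using 1
  rw [map_sub, algebraMap_tmul, algebraMap_tmul, ← hα, mul_sub, mul_one, neg_sub, ← map_mul,
    Algebra.TensorProduct.tmul_mul_tmul, mul_inv_cancel₀ hα₀, one_mul, map_one]

end Tate

section CurveRing

theorem isUnit_of_mem_nonZeroDivisors_of_surjective {R K : Type*} [CommRing R] [Field K]
    {φ : K →+* R} (hφ : Function.Surjective φ) {s : R} (hs : s ∈ R⁰) : IsUnit s := by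
  obtain ⟨k, rfl⟩ := hφ s
  rcases eq_or_ne k 0 with rfl | hk
  · rw [map_zero] at hs ⊢
    exact isUnit_zero_iff.2 ((mem_nonZeroDivisors_iff.1 hs).1 1 (zero_mul 1)).symm
  · exact (IsUnit.mk0 k hk).map φ

theorem exists_clearsPoles_isUnit {F K : Type u} [Field F] [Fintype F] [Field K] [Algebra F K]
    [IsCurveFunctionField F K] (P : ClosedPoint F K) :
    ∃ u, ClearsPoles (idealJ F P.regularAway K) u ∧
      ∀ (L : Type u) [NormedField L] [Algebra F L] [Algebra K L] [IsScalarTower F K L],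
        (∀ k : K, ‖algebraMap K L k‖ = P.abv k) →
          IsUnit (algebraMap _ (Tate F P.regularAway L) u) := by
  by_cases h : ∃ a : P.regularAway, (a : K) ∉ P.localRing
  · obtain ⟨a, ha⟩ := h
    refine ⟨a ⊗ₜ 1 - 1 ⊗ₜ algebraMap P.regularAway K a, clearsPoles_of_mem ?_, fun L _ _ _ _ hL =>
      isUnit_algebraMap_tmul_one_sub_one_tmul (by rw [hL]; exact P.one_lt_abv ha)⟩
    simp [idealJ, RingHom.mem_ker]
  · push Not at h
    -- Here `A = F`, so that `𝔧 = 0` contains no unit, but `A ⊗ K = K` is a field.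
    have hA : Function.Surjective (algebraMap F P.regularAway) := fun a =>
      (P.mem_range_algebraMap a.2 (h a)).imp fun _ hc => Subtype.ext hc
    refine ⟨1, clearsPoles_of_forall_isUnit (fun s hs => ?_) _ _, fun L _ _ _ _ _ => by simp⟩
    exact isUnit_of_mem_nonZeroDivisors_of_surjective
      (φ := (Algebra.TensorProduct.includeRight : K →ₐ[F] P.regularAway ⊗[F] K).toRingHom)
      (Algebra.TensorProduct.includeRight_surjective _ hA) hs

end CurveRing

section Frobenius

variable {F A K : Type u} [Field F] [Fintype F] [CommRing A] [Algebra F A] [Field K] [Algebra F K]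
  [Algebra A K] [IsScalarTower F A K] {M : AMotive F A K}
  {L : Type u} [NormedField L] [Algebra F L] [Algebra K L] [IsScalarTower F K L]

theorem ClearsPoles.bijective_toInv {u : A ⊗[F] K} (h : ClearsPoles (idealJ F A K) u)
    (hu : IsUnit (algebraMap _ (Tate F A L) u)) (M : AMotive F A K) :
    Function.Bijective (M.toInv L) :=
  bijective_lTensor_of_forall_pow_smul_mem_range hu (InvAlong.ι_injective _) (h M.carrier)

namespace AMotive

theorem toInv_smul (s : Tate F A L) (x : M.Ext L) : M.toInv L (s • x) = s • M.toInv L x :=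
  map_smul (LinearMap.baseChange (Tate F A L) (InvAlong.ι (idealJ F A K) M.carrier)) s x

theorem τExt_smul (s : Tate F A L)
    (x : Tate F A L ⊗[A ⊗[F] K] Pullback (tensorFrob F A K) M.carrier) :
    M.τExt L (s • x) = s • M.τExt L x :=
  map_smul (LinearMap.baseChange (Tate F A L)
    (M.τ.toLinearMap ∘ₗ InvAlong.ι (idealJ F A K) (Pullback (tensorFrob F A K) M.carrier))) s x

theorem pullExt_smul (s : Tate F A L) (x : M.Ext L) :
    M.pullExt L (s • x) = Tate.frob F A L s • M.pullExt L x := by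
  induction x using TensorProduct.induction_on with
  | zero => rw [smul_zero, map_zero, smul_zero]
  | add x y hx hy => rw [smul_add, map_add, map_add, hx, hy, smul_add]
  | tmul t m =>
    rw [TensorProduct.smul_tmul', pullExt_tmul, pullExt_tmul, TensorProduct.smul_tmul',
      smul_eq_mul, smul_eq_mul, map_mul]

/-- The Frobenius operator `ω ↦ τ_M(τ^* ω)` of `M ⊗ L⟨A⟩`, for `L` such that
`M ⊗ L⟨A⟩ = M[𝔧⁻¹] ⊗ L⟨A⟩`. -/
def frobExt (hb : Function.Bijective (M.toInv L)) : M.Ext L →ₛₗ[Tate.frob F A L] M.Ext L where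
  toFun x := (LinearEquiv.ofBijective (M.toInv L) hb).symm (M.τExt L (M.pullExt L x))
  map_add' x y := by simp only [map_add]
  map_smul' s x := by
    rw [LinearEquiv.symm_apply_eq, LinearEquiv.ofBijective_apply, toInv_smul, pullExt_smul,
      τExt_smul, ← LinearEquiv.ofBijective_apply (f := M.toInv L) (hf := hb),
      LinearEquiv.apply_symm_apply]

theorem toInv_frobExt (hb : Function.Bijective (M.toInv L)) (x : M.Ext L) :
    M.toInv L (frobExt hb x) = M.τExt L (M.pullExt L x) :=
  (LinearEquiv.ofBijective _ hb).apply_symm_apply (M.τExt L (M.pullExt L x))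

theorem mem_betti_iff_frobExt_eq (hb : Function.Bijective (M.toInv L)) {x : M.Ext L} :
    x ∈ M.betti L ↔ frobExt hb x = x := by
  rw [mem_betti, ← toInv_frobExt hb, hb.1.eq_iff, eq_comm]

section Naturality

variable {N : AMotive F A K}

theorem toInv_extMap (f : M ⟶ N) (x : M.Ext L) : N.toInv L (extMap L f x) =
    LinearMap.lTensor _ (InvAlong.map (idealJ F A K) f.lin) (M.toInv L x) := by
  have h : InvAlong.ι (idealJ F A K) N.carrier ∘ₗ f.lin =
      InvAlong.map (idealJ F A K) f.lin ∘ₗ InvAlong.ι (idealJ F A K) M.carrier :=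
    LinearMap.ext fun x => (InvAlong.map_ι (idealJ F A K) f.lin x).symm
  simp only [toInv, extMap, ← LinearMap.comp_apply, ← LinearMap.lTensor_comp, h]

theorem τExt_lTensor (f : M ⟶ N)
    (x : Tate F A L ⊗[A ⊗[F] K] Pullback (tensorFrob F A K) M.carrier) :
    N.τExt L (LinearMap.lTensor _ (Pullback.map (tensorFrob F A K) f.lin) x) =
      LinearMap.lTensor _ (InvAlong.map (idealJ F A K) f.lin) (M.τExt L x) := by
  have h : InvAlong.ι (idealJ F A K) _ ∘ₗ Pullback.map (tensorFrob F A K) f.lin =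
      InvAlong.map (idealJ F A K) (Pullback.map (tensorFrob F A K) f.lin) ∘ₗ
        InvAlong.ι (idealJ F A K) _ :=
    LinearMap.ext fun x => (InvAlong.map_ι (idealJ F A K) _ x).symm
  simp only [τExt, ← LinearMap.comp_apply, ← LinearMap.lTensor_comp]
  rw [LinearMap.comp_assoc, h, ← LinearMap.comp_assoc, ← f.comm, LinearMap.comp_assoc]

theorem extMap_frobExt (hM : Function.Bijective (M.toInv L)) (hN : Function.Bijective (N.toInv L))
    (f : M ⟶ N) (x : M.Ext L) : extMap L f (frobExt hM x) = frobExt hN (extMap L f x) :=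
  hN.1 (by rw [toInv_extMap, toInv_frobExt, toInv_frobExt, pullExt_extMap, τExt_lTensor])

end Naturality

theorem mapExt_frobExt {L' : Type u} [NormedField L'] [Algebra F L'] [Algebra K L']
    [IsScalarTower F K L'] (hb : Function.Bijective (M.toInv L))
    (hb' : Function.Bijective (M.toInv L')) (g : L →ₐ[K] L') (hg : Continuous g) (x : M.Ext L) :
    M.mapExt g hg (frobExt hb x) = frobExt hb' (M.mapExt g hg x) := by
  have htoInv (x : M.Ext L) : M.toInv L' (M.mapExt g hg x) =
      LinearMap.rTensor _ (Tate.mapAlg F A K g hg).toLinearMap (M.toInv L x) := by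
    simp only [toInv, mapExt, ← LinearMap.comp_apply, LinearMap.lTensor_comp_rTensor,
      LinearMap.rTensor_comp_lTensor]
  have hτExt (y) : M.τExt L' (LinearMap.rTensor _ (Tate.mapAlg F A K g hg).toLinearMap y) =
      LinearMap.rTensor _ (Tate.mapAlg F A K g hg).toLinearMap (M.τExt L y) := by
    simp only [τExt, ← LinearMap.comp_apply, LinearMap.lTensor_comp_rTensor,
      LinearMap.rTensor_comp_lTensor]
  exact hb'.1 (by rw [htoInv, toInv_frobExt, toInv_frobExt, pullExt_mapExt, hτExt])

section Exact

variable {M' M'' : AMotive F A K} {f : M' ⟶ M} {g : M ⟶ M''}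

theorem injective_extMap (hf : Function.Injective f.lin) (hfg : Function.Exact f.lin g.lin)
    (hg : Function.Surjective g.lin) : Function.Injective (extMap L f) := by
  obtain ⟨s, hs⟩ := Module.projective_lifting_property g.lin LinearMap.id hg
  have hsplit := (hfg.split_tfae hf hg).out 0 1
  obtain ⟨r, hr⟩ := hsplit.1 ⟨s, hs⟩
  refine Function.LeftInverse.injective (g := LinearMap.lTensor (Tate F A L) r) fun x => ?_
  rw [extMap, ← LinearMap.comp_apply, ← LinearMap.lTensor_comp, hr, LinearMap.lTensor_id,
    LinearMap.id_apply]

theorem exact_extMap (hfg : Function.Exact f.lin g.lin) (hg : Function.Surjective g.lin) :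
    Function.Exact (extMap L f) (extMap L g) :=
  lTensor_exact (Tate F A L) hfg hg

theorem surjective_extMap (hg : Function.Surjective g.lin) : Function.Surjective (extMap L g) :=
  LinearMap.lTensor_surjective (Tate F A L) hg

theorem injective_bettiMap (hf : Function.Injective f.lin) (hfg : Function.Exact f.lin g.lin)
    (hg : Function.Surjective g.lin) : Function.Injective (bettiMap L f) :=
  fun _ _ h => Subtype.ext (injective_extMap hf hfg hg (congrArg Subtype.val h))

theorem exact_bettiMap (hM' : Function.Bijective (M'.toInv L)) (hM : Function.Bijective (M.toInv L))
    (hf : Function.Injective f.lin) (hfg : Function.Exact f.lin g.lin)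
    (hg : Function.Surjective g.lin) : Function.Exact (bettiMap L f) (bettiMap L g) := by
  refine fun ω => ⟨fun h => ?_, ?_⟩
  · obtain ⟨x, hx⟩ := (exact_extMap (L := L) hfg hg ω).1 (congrArg Subtype.val h)
    refine ⟨⟨x, (mem_betti_iff_frobExt_eq hM').2 (injective_extMap hf hfg hg ?_)⟩, Subtype.ext hx⟩
    rw [extMap_frobExt hM' hM, hx, (mem_betti_iff_frobExt_eq hM).1 ω.2]
  · rintro ⟨ω', rfl⟩
    exact Subtype.ext ((exact_extMap hfg hg (extMap L f ω')).2 ⟨ω', rfl⟩)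

theorem surjective_bettiMap (hM' : Function.Bijective (M'.toInv L))
    (hM : Function.Bijective (M.toInv L)) (hM'' : Function.Bijective (M''.toInv L))
    (hsurj : ∀ y, ∃ x, x - frobExt hM' x = y) (hfg : Function.Exact f.lin g.lin)
    (hg : Function.Surjective g.lin) : Function.Surjective (bettiMap L g) := by
  intro ω
  obtain ⟨x, hx⟩ := surjective_extMap (L := L) hg ω
  have hker : extMap L g (x - frobExt hM x) = 0 := by
    rw [map_sub, extMap_frobExt hM hM'', hx, (mem_betti_iff_frobExt_eq hM'').1 ω.2, sub_self]
  obtain ⟨y, hy⟩ := (exact_extMap (L := L) hfg hg _).1 hker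
  obtain ⟨z, rfl⟩ := hsurj y
  rw [map_sub, extMap_frobExt hM' hM] at hy
  refine ⟨⟨x - extMap L f z, (mem_betti_iff_frobExt_eq hM).2 ?_⟩, Subtype.ext ?_⟩
  · rw [map_sub]
    exact (sub_eq_sub_iff_sub_eq_sub.1 hy.symm).symm
  · change extMap L g (x - extMap L f z) = ω
    rw [map_sub, hx, (exact_extMap (L := L) hfg hg _).2 ⟨z, rfl⟩, sub_zero]

theorem exists_sub_frobExt_eq (hb : Function.Bijective (M.toInv L))
    (hL : ∀ s : Tate F A L, ∃ d, d - Tate.frob F A L d = s) (hM : M.IsRigidAnalyticallyTrivial L)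
    (y : M.Ext L) : ∃ x, x - frobExt hb x = y := by
  obtain ⟨z, rfl⟩ := hM.2 y
  induction z using TensorProduct.induction_on with
  | zero => exact ⟨0, by simp only [map_zero, sub_zero]⟩
  | add z z' hz hz' =>
    obtain ⟨x, hx⟩ := hz
    obtain ⟨x', hx'⟩ := hz'
    exact ⟨x + x', by rw [map_add, map_add, add_sub_add_comm, hx, hx']⟩
  | tmul s ω =>
    obtain ⟨d, rfl⟩ := hL s
    refine ⟨d • (ω : M.Ext L), ?_⟩
    rw [map_smulₛₗ, (mem_betti_iff_frobExt_eq hb).1 ω.2, LinearMap.liftBaseChange_tmul, sub_smul]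
    rfl

end Exact

end AMotive

end Frobenius

section Cinf

variable {F K : Type u} [Field F] [Fintype F] [Field K] [Algebra F K] (P : ClosedPoint F K)

instance : IsUltrametricDist (KinfSep P) :=
  IsUltrametricDist.isUltrametricDist_of_forall_norm_add_le_max_norm
    (isNonarchimedean_spectralNorm (K := Kinf P) (L := KinfSep P))

theorem norm_toCinf (x : KinfSep P) : ‖toCinf P x‖ = ‖x‖ :=
  UniformSpace.Completion.norm_coe (E := KinfSep P) x

instance : IsUltrametricDist (Cinf P) := by
  refine IsUltrametricDist.isUltrametricDist_of_forall_norm_add_le_max_norm fun x y => ?_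
  induction x, y using (denseRange_toCinf P).induction_on₂ with
  | hp =>
    exact isClosed_le (continuous_fst.add continuous_snd).norm
      (continuous_fst.norm.max continuous_snd.norm)
  | h a b =>
    rw [← map_add, norm_toCinf, norm_toCinf, norm_toCinf]
    exact IsUltrametricDist.norm_add_le_max a b

theorem norm_algebraMap_Kinf_Cinf (x : Kinf P) : ‖algebraMap (Kinf P) (Cinf P) x‖ = ‖x‖ :=
  (norm_toCinf P _).trans (spectralNorm_extends x)

theorem norm_algebraMap_Cinf (k : K) : ‖algebraMap K (Cinf P) k‖ = P.abv k :=
  (norm_algebraMap_Kinf_Cinf P _).trans (norm_toKinf P k)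

instance : Algebra F (KinfSep P) :=
  ((algebraMap (Kinf P) (KinfSep P)).comp (algebraMap F (Kinf P))).toAlgebra

/-- The inclusion `K_∞^s ⊂ ℂ_∞`, as a homomorphism of `𝔽`-algebras. -/
def toCinfAlgHom : KinfSep P →ₐ[F] Cinf P where
  __ := toCinf P
  commutes' f := (IsScalarTower.algebraMap_apply F (Kinf P) (Cinf P) f).symm

theorem exists_sub_pow_card_eq (c : KinfSep P) : ∃ d, d - d ^ Fintype.card F = c := by
  have : IsSepClosed (KinfSep P) := IsSepClosure.sep_closed (Kinf P)
  have hq : (Fintype.card F : KinfSep P) = 0 := by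
    rw [← map_natCast (algebraMap F (KinfSep P)), Nat.cast_card_eq_zero, map_zero]
  obtain ⟨d, hd⟩ := IsSepClosed.exists_root_C_mul_X_pow_add_C_mul_X_add_C (-1) 1 (-c) hq
    Fintype.one_lt_card one_ne_zero
  exact ⟨d, by linear_combination hd⟩

variable {P} {A : Type u} [CommRing A] [Algebra F A]

theorem Tate.exists_sub_frob_eq (x : Tate F A (Cinf P)) :
    ∃ y, y - Tate.frob F A (Cinf P) y = x := by
  have hmap (z : A ⊗[F] KinfSep P) : ∃ y, y - Tate.frob F A (Cinf P) y =
      toTate F A (Cinf P) (Algebra.TensorProduct.map (.id F A) (toCinfAlgHom P) z) := by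
    induction z using TensorProduct.induction_on with
    | zero => exact ⟨0, by simp only [map_zero, sub_zero]⟩
    | add z z' hz hz' =>
      obtain ⟨y, hy⟩ := hz
      obtain ⟨y', hy'⟩ := hz'
      exact ⟨y + y', by simp only [map_add, add_sub_add_comm, hy, hy']⟩
    | tmul a c =>
      obtain ⟨d, rfl⟩ := exists_sub_pow_card_eq P c
      refine ⟨toTate F A (Cinf P) (a ⊗ₜ toCinfAlgHom P d), ?_⟩
      rw [frob_tmul, ← map_sub, ← TensorProduct.tmul_sub, ← map_pow, ← map_sub,
        Algebra.TensorProduct.map_tmul, AlgHom.id_apply]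
  have hdense : DenseRange (toCinfAlgHom P) := denseRange_toCinf P
  obtain ⟨z, hz⟩ := exists_sub_toTate_map_mem_ball (A := A) hdense x ⟨1 / 2, by norm_num⟩
  obtain ⟨y, hy⟩ := exists_sub_frob_eq_of_mem_ball one_half_lt_one hz
  obtain ⟨y', hy'⟩ := hmap z
  exact ⟨y + y', by rw [map_add, add_sub_add_comm, hy, hy', sub_add_cancel]⟩

end Cinf

section Finiteness

theorem finite_of_finite_tensorProduct_of_retraction {A T V : Type*} [CommRing A] [CommRing T]
    [Algebra A T] [AddCommGroup V] [Module A V] (ψ : T →ₗ[A] A) (hψ : ψ 1 = 1)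
    [Module.Finite T (T ⊗[A] V)] : Module.Finite A V := by
  obtain ⟨s, hs, hspan⟩ := Submodule.fg_def.1 (Module.Finite.fg_top (R := T) (M := T ⊗[A] V))
  obtain ⟨N, hN, hsN⟩ := TensorProduct.exists_finite_submodule_right_of_setFinite s hs
  have hsurj : Function.Surjective (N.subtype.baseChange T) := by
    rw [← LinearMap.range_eq_top, eq_top_iff, ← hspan, Submodule.span_le]
    exact hsN
  have hretract (z : T ⊗[A] N) : TensorProduct.lid A V (ψ.rTensor V (N.subtype.baseChange T z)) =
      TensorProduct.lid A N (ψ.rTensor N z) := by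
    induction z using TensorProduct.induction_on with
    | zero => simp only [map_zero, ZeroMemClass.coe_zero]
    | add x y hx hy => simp only [map_add, hx, hy, Submodule.coe_add]
    | tmul t v => simp
  have htop : N = ⊤ := by
    refine Submodule.eq_top_iff'.2 fun v => ?_
    obtain ⟨z, hz⟩ := hsurj (1 ⊗ₜ v)
    have hv := hretract z
    rw [hz, LinearMap.rTensor_tmul, hψ, TensorProduct.lid_tmul, one_smul] at hv
    exact hv ▸ Subtype.property _
  exact Module.Finite.equiv (Submodule.topEquiv.symm.trans (LinearEquiv.ofEq ⊤ N htop.symm)).symm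

variable (F A L : Type u) [Field F] [CommRing A] [Algebra F A] [NormedField L] [Algebra F L]

theorem exists_linearMap_eq_one [Finite F] [IsUltrametricDist L] :
    ∃ φ : L →ₗ[F] F, φ 1 = 1 ∧ ∀ c, ‖c‖ ≤ 1 / 2 → φ c = 0 := by
  let B : Submodule F L :=
    { carrier := {c | ‖c‖ ≤ 1 / 2}
      zero_mem' := by simp
      add_mem' hx hy := (IsUltrametricDist.norm_add_le_max _ _).trans (max_le hx hy)
      smul_mem' f c hc := (norm_smul_le_of_finite f c).trans hc }
  have hone : (1 : L) ∉ B := by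
    change ¬ ‖(1 : L)‖ ≤ 1 / 2
    norm_num
  obtain ⟨f, hf, hB⟩ := Submodule.exists_le_ker_of_notMem hone
  refine ⟨(f 1)⁻¹ • f, inv_mul_cancel₀ hf, fun c hc => ?_⟩
  rw [LinearMap.smul_apply, LinearMap.mem_ker.1 (hB hc), smul_zero]

variable {F A L}

theorem Tate.exists_linearMap_toTate_eq {N : Type*} [AddCommGroup N] [Module A N]
    (ψ₀ : A ⊗[F] L →ₗ[A] N) {r : {r : ℝ // 0 < r}} (hψ₀ : ∀ a c, ‖c‖ ≤ r → ψ₀ (a ⊗ₜ c) = 0) :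
    ∃ ψ : Tate F A L →ₗ[A] N, ∀ x, ψ (toTate F A L x) = ψ₀ x := by
  let _ : UniformSpace N := ⊥
  have : DiscreteUniformity N := inferInstance
  let f : PreTate F A L →+ N := ψ₀.toAddMonoidHom.comp (PreTate.of F A L).symm
  have hf : Continuous f := by
    refine continuous_of_continuousAt_zero f ?_
    rw [ContinuousAt, map_zero, nhds_discrete N, Filter.tendsto_pure]
    filter_upwards [(PreTate.ringSubgroupsBasis F A L).hasBasis_nhds_zero.mem_of_mem (i := r)
      trivial] with x hx
    refine (AddSubgroup.closure_le f.ker).2 ?_ hx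
    rintro _ ⟨a, c, hc, rfl⟩
    exact hψ₀ a c hc
  have hext : Continuous (f.extension hf) := f.continuous_extension hf
  have hcoe (x : A ⊗[F] L) : f.extension hf (toTate F A L x) = ψ₀ x := f.extension_coe hf _
  have hsmul (a : A) (x : A ⊗[F] L) : a • toTate F A L x = toTate F A L (a • x) := by
    rw [Algebra.smul_def, Algebra.smul_def, map_mul]
    rfl
  refine ⟨{ f.extension hf with map_smul' := fun a => congrFun (Tate.hom_ext ?_ ?_ fun x => ?_) },
    hcoe⟩
  · simp only [Algebra.smul_def]
    exact hext.comp (continuous_const_mul _)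
  · exact continuous_of_discreteTopology.comp hext
  · change f.extension hf (a • toTate F A L x) = a • f.extension hf (toTate F A L x)
    rw [hsmul, hcoe, hcoe, map_smul]

variable (F A L) [Finite F] [IsUltrametricDist L]

theorem Tate.exists_retraction : ∃ ψ : Tate F A L →ₗ[A] A, ψ 1 = 1 := by
  obtain ⟨φ, hφ, hφ₀⟩ := exists_linearMap_eq_one F L
  let ψ₀ : A ⊗[F] L →ₗ[A] A :=
    AlgebraTensorModule.rid F A A ∘ₗ AlgebraTensorModule.lTensor A A φ
  have hψ₀ (a : A) (c : L) : ψ₀ (a ⊗ₜ c) = φ c • a := rfl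
  obtain ⟨ψ, hψ⟩ := Tate.exists_linearMap_toTate_eq ψ₀ (r := ⟨1 / 2, by norm_num⟩)
    fun a c hc => by rw [hψ₀, hφ₀ c hc, zero_smul]
  refine ⟨ψ, ?_⟩
  rw [← map_one (toTate F A L), hψ, Algebra.TensorProduct.one_def, hψ₀, hφ, one_smul]

end Finiteness

section FiniteBetti

variable {F A K : Type u} [Field F] [Fintype F] [CommRing A] [Algebra F A] [Field K] [Algebra F K]
  [Algebra A K] [IsScalarTower F A K] {M : AMotive F A K}
  {L : Type u} [NormedField L] [IsUltrametricDist L] [Algebra F L] [Algebra K L]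
  [IsScalarTower F K L]

theorem AMotive.finite_betti (hM : M.IsRigidAnalyticallyTrivial L) :
    Module.Finite A (M.betti L) := by
  have : Module.Finite (Tate F A L) (Tate F A L ⊗[A] M.betti L) :=
    Module.Finite.equiv (LinearEquiv.ofBijective _ hM).symm
  obtain ⟨ψ, hψ⟩ := Tate.exists_retraction F A L
  exact finite_of_finite_tensorProduct_of_retraction (V := M.betti L) ψ hψ

end FiniteBetti

section FrobeniusFixedVectors

open Filter Topology

variable {F A L : Type u} [Field F] [CommRing A] [Algebra F A] [NormedField L] [Algebra F L]
  {ι : Type*}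

theorem Tate.hasBasis_nhds_zero_pi [Finite ι] : (𝓝 (0 : ι → Tate F A L)).HasBasis (fun _ => True)
    fun r => {x | ∀ i, x i ∈ Tate.ball F A L r} := by
  refine ⟨fun U => ⟨fun hU => ?_, fun ⟨r, _, hr⟩ => mem_of_superset ?_ hr⟩⟩
  · rw [nhds_pi] at hU
    obtain ⟨⟨I, ρ⟩, -, hI⟩ :=
      (hasBasis_pi fun _ : ι => Tate.hasBasis_nhds_zero (F := F) (A := A) (L := L)).mem_iff.1 hU
    obtain ⟨r, hr⟩ := Finite.exists_ge ρ
    exact ⟨r, trivial, fun x hx => hI fun i _ => Tate.ball_mono (hr i) (hx i)⟩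
  · exact eventually_all.2 fun i =>
      (continuous_apply i).continuousAt.preimage_mem_nhds (Tate.ball_mem_nhds r)

variable [Fintype F] [Fintype ι]

/-- The operator `x ↦ Φ τ(x)` on vectors over `L⟨A⟩`: the Frobenius of an `A`-motive written in
coordinates. -/
def Tate.frobMul (Φ : Matrix ι ι (Tate F A L)) : (ι → Tate F A L) →+ (ι → Tate F A L) :=
  Φ.mulVecLin.toAddMonoidHom.comp ((Tate.frob F A L).toAddMonoidHom.compLeft ι)

theorem Tate.frobMul_apply (Φ : Matrix ι ι (Tate F A L)) (x : ι → Tate F A L) (i : ι) :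
    Tate.frobMul Φ x i = ∑ j, Φ i j * Tate.frob F A L (x j) := rfl

theorem Tate.exists_tendsto_iterate_frobMul (Φ : Matrix ι ι (Tate F A L)) :
    ∃ r, ∀ x : ι → Tate F A L, (∀ i, x i ∈ Tate.ball F A L r) →
      Tendsto (fun k => (Tate.frobMul Φ)^[k] x) atTop (𝓝 0) := by
  obtain ⟨R, hR⟩ := Tate.exists_forall_mem_ball fun ij : ι × ι => Φ ij.1 ij.2
  let c : {r : ℝ // 0 < r} := ⟨1 / 2, by norm_num⟩
  refine ⟨min 1 (c * R⁻¹), fun x hx => tendsto_iterate_nhds Tate.hasBasis_nhds_zero_pi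
    (fun _ _ h y hy i => Tate.ball_mono h (hy i)) (c := c) one_half_lt_one
    (fun s hs y hy i => sum_mem fun j _ => ?_) hx⟩
  have hs₁ : (s : ℝ) ≤ 1 := hs.trans (min_le_left _ _)
  have hs₂ : (R : ℝ) * s ≤ 1 / 2 := by
    have h : (s : ℝ) ≤ 1 / 2 * (R : ℝ)⁻¹ := hs.trans (min_le_right _ _)
    rwa [← div_eq_mul_inv, le_div_iff₀' R.2] at h
  refine Tate.mul_mem_ball ?_ (hR (i, j))
    (Tate.frob_mem_ball (s := s ^ 2)
    (pow_le_pow_of_le_one s.2.le hs₁ Fintype.one_lt_card) (hy j))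
  calc (R : ℝ) * s ^ 2 = R * s * s := by ring
    _ ≤ 1 / 2 * s := mul_le_mul_of_nonneg_right hs₂ s.2.le

variable {K L' : Type u} [Field K] [Algebra F K] [Algebra K L] [IsScalarTower F K L]
  [NormedField L'] [Algebra F L'] [Algebra K L'] [IsScalarTower F K L']
  [IsUltrametricDist L] [IsUltrametricDist L']

theorem Tate.mem_range_mapAlg_of_frobMul_eq {g : L →ₐ[K] L'} (hg : ∀ c, ‖g c‖ = ‖c‖)
    (hc : Continuous g) {Φ : Matrix ι ι (Tate F A L')}
    (hΦ : ∀ i j, Φ i j ∈ (Tate.mapAlg F A K g hc).range) {x y : ι → Tate F A L'}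
    (hx : Tate.frobMul Φ x = x) (hy : ∀ i, y i ∈ (Tate.mapAlg F A K g hc).range)
    (hxy : Tendsto (fun k => (Tate.frobMul Φ)^[k] (x - y)) atTop (𝓝 0)) (i : ι) :
    x i ∈ (Tate.mapAlg F A K g hc).range := by
  let T : Subring (Tate F A L') := (Tate.mapAlg F A K g hc).range.toSubring
  let S : AddSubgroup (ι → Tate F A L') := AddSubgroup.pi Set.univ fun _ => T.toAddSubgroup
  have hS : IsClosed (S : Set (ι → Tate F A L')) :=
    isClosed_set_pi fun _ _ => Tate.isClosed_range_mapAlg hg hc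
  have hfrob {s : Tate F A L'} (hs : s ∈ T) : Tate.frob F A L' s ∈ T := by
    obtain ⟨t, rfl⟩ := hs
    exact ⟨Tate.frob F A L t, Tate.mapAlg_frob F A K g hc t⟩
  have hfS : Set.MapsTo (Tate.frobMul Φ) S S := fun z hz j _ =>
    T.sum_mem fun k _ => T.mul_mem (hΦ j k) (hfrob (hz k trivial))
  exact mem_of_tendsto_iterate_sub hS hfS hx (fun j _ => hy j) hxy i trivial

end FrobeniusFixedVectors

section Coordinates

theorem exists_dual_sum_smul_eq (R M : Type*) [CommRing R] [AddCommGroup M] [Module R M]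
    [Module.Finite R M] [Module.Projective R M] :
    ∃ (n : ℕ) (m : Fin n → M) (ξ : Fin n → Module.Dual R M), ∀ x, ∑ i, ξ i x • m i = x := by
  obtain ⟨n, f, g, -, -, hfg⟩ := Module.Finite.exists_comp_eq_id_of_projective R M
  refine ⟨n, fun i => f (Pi.single i 1), fun i => LinearMap.proj i ∘ₗ g, fun x => ?_⟩
  calc ∑ i, g x i • f (Pi.single i 1) = f (∑ i, g x i • Pi.single i 1) := by
        simp only [map_sum, map_smul]
    _ = f (g x) := by rw [← pi_eq_sum_univ']
    _ = x := LinearMap.congr_fun hfg x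

theorem sum_baseChange_smul_one_tmul {R M T ι : Type*} [CommRing R] [AddCommGroup M] [Module R M]
    [CommRing T] [Algebra R T] [Fintype ι] {m : ι → M} {ξ : ι → Module.Dual R M}
    (h : ∀ x, ∑ i, ξ i x • m i = x) (x : T ⊗[R] M) :
    ∑ i, (ξ i).baseChange T x • ((1 : T) ⊗ₜ[R] m i) = x := by
  induction x using TensorProduct.induction_on with
  | zero => simp only [map_zero, zero_smul, Finset.sum_const_zero]
  | add x y hx hy => simp only [map_add, add_smul, Finset.sum_add_distrib, hx, hy]
  | tmul t v =>
    conv_rhs => rw [← h v, TensorProduct.tmul_sum]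
    refine Finset.sum_congr rfl fun i _ => ?_
    rw [Module.Dual.baseChange_apply_tmul, smul_assoc, TensorProduct.smul_tmul',
      smul_eq_mul, mul_one, TensorProduct.smul_tmul', TensorProduct.smul_tmul]

end Coordinates

section BettiCoordinates

variable {F A K : Type u} [Field F] [Fintype F] [CommRing A] [Algebra F A] [Field K] [Algebra F K]
  [Algebra A K] [IsScalarTower F A K] {M : AMotive F A K}
  {L : Type u} [NormedField L] [Algebra F L] [Algebra K L] [IsScalarTower F K L]
  {L' : Type u} [NormedField L'] [Algebra F L'] [Algebra K L'] [IsScalarTower F K L']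
  {ι : Type*} {m : ι → M.carrier} {ξ : ι → Module.Dual (A ⊗[F] K) M.carrier}

namespace AMotive

theorem baseChange_mapExt (φ : Module.Dual (A ⊗[F] K) M.carrier) (g : L →ₐ[K] L')
    (hg : Continuous g) (x : M.Ext L) : φ.baseChange (Tate F A L') (M.mapExt g hg x) =
      Tate.mapAlg F A K g hg (φ.baseChange (Tate F A L) x) := by
  induction x using TensorProduct.induction_on with
  | zero => simp only [map_zero]
  | add x y hx hy => simp only [map_add, hx, hy]
  | tmul t v =>
    rw [mapExt_tmul, Module.Dual.baseChange_apply_tmul, Module.Dual.baseChange_apply_tmul, map_smul]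

/-- The matrix of the Frobenius operator `ω ↦ τ_M(τ^* ω)` with respect to generators `m` of `M`
and linear forms `ξ` giving coordinates; they need not form a basis, as `M` is only projective. -/
def frobMatrix (hb : Function.Bijective (M.toInv L)) (m : ι → M.carrier)
    (ξ : ι → Module.Dual (A ⊗[F] K) M.carrier) : Matrix ι ι (Tate F A L) :=
  .of fun i j => (ξ i).baseChange (Tate F A L) (frobExt hb (1 ⊗ₜ m j))

theorem mapAlg_frobMatrix (hb : Function.Bijective (M.toInv L))
    (hb' : Function.Bijective (M.toInv L')) (g : L →ₐ[K] L') (hg : Continuous g) (i j : ι) :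
    Tate.mapAlg F A K g hg (frobMatrix hb m ξ i j) = frobMatrix hb' m ξ i j := by
  rw [frobMatrix, frobMatrix, Matrix.of_apply, Matrix.of_apply, ← baseChange_mapExt,
    mapExt_frobExt hb hb', mapExt_tmul, map_one]

theorem mem_of_span_betti_eq_top {W : Set (M.betti L)} (hW : Submodule.span A W = ⊤)
    {V : Submodule (A ⊗[F] K) (M.Ext L)} (hWV : ∀ w ∈ W, (w : M.Ext L) ∈ V) {ω : M.Ext L}
    (hω : ω ∈ M.betti L) : ω ∈ V := by
  have hV : Submodule.span A W ≤ (V.restrictScalars A).comap (M.betti L).subtype :=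
    Submodule.span_le.2 hWV
  exact hV (x := ⟨ω, hω⟩) (hW ▸ trivial)

variable [Fintype ι]

theorem frobMul_frobMatrix (hb : Function.Bijective (M.toInv L)) (h : ∀ x, ∑ i, ξ i x • m i = x)
    (ω : M.Ext L) : Tate.frobMul (frobMatrix hb m ξ) (fun i => (ξ i).baseChange _ ω) =
      fun i => (ξ i).baseChange _ (frobExt hb ω) := by
  ext i
  conv_rhs => rw [← sum_baseChange_smul_one_tmul h ω]
  simp only [Tate.frobMul_apply, map_sum, map_smulₛₗ, smul_eq_mul, mul_comm]
  rfl

theorem mem_range_mapExt_of_forall_dual (h : ∀ x, ∑ i, ξ i x • m i = x) {g : L →ₐ[K] L'}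
    (hg : Continuous g) {ω : M.Ext L'}
    (hω : ∀ i, (ξ i).baseChange (Tate F A L') ω ∈ (Tate.mapAlg F A K g hg).range) :
    ω ∈ LinearMap.range (M.mapExt g hg) := by
  choose t ht using hω
  refine ⟨∑ i, t i ⊗ₜ m i, ?_⟩
  conv_rhs => rw [← sum_baseChange_smul_one_tmul h ω]
  rw [map_sum]
  refine Finset.sum_congr rfl fun i _ => ?_
  rw [mapExt_tmul, TensorProduct.smul_tmul', smul_eq_mul, mul_one, ← ht i]
  rfl

theorem mem_range_mapExt_of_tendsto [IsUltrametricDist L] [IsUltrametricDist L']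
    (hb : Function.Bijective (M.toInv L)) (hb' : Function.Bijective (M.toInv L'))
    (h : ∀ x, ∑ i, ξ i x • m i = x) {g : L →ₐ[K] L'} (hg : ∀ c, ‖g c‖ = ‖c‖) (hc : Continuous g)
    {ω : M.Ext L'} (hω : ω ∈ M.betti L') {y : ι → Tate F A L'}
    (hy : ∀ i, y i ∈ (Tate.mapAlg F A K g hc).range)
    (hωy : Filter.Tendsto (fun k => (Tate.frobMul (frobMatrix hb' m ξ))^[k]
      ((fun i => (ξ i).baseChange (Tate F A L') ω) - y)) .atTop (nhds 0)) :
    ω ∈ LinearMap.range (M.mapExt g hc) := by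
  refine mem_range_mapExt_of_forall_dual h hc fun i =>
    Tate.mem_range_mapAlg_of_frobMul_eq hg hc (Φ := frobMatrix hb' m ξ)
      (fun j k => ⟨_, mapAlg_frobMatrix hb hb' g hc j k⟩) ?_ hy hωy i
  rw [frobMul_frobMatrix hb' h, (mem_betti_iff_frobExt_eq hb').1 hω]

end AMotive

end BettiCoordinates

section FieldOfDefinition

variable {F K : Type u} [Field F] [Fintype F] [Field K] [Algebra F K] {P : ClosedPoint F K}
  {A : Type u} [CommRing A] [Algebra F A]

/-- The image in `ℂ_∞` of a subextension of `K_∞^s / K_∞`. -/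
abbrev cinfImage (E : IntermediateField (Kinf P) (KinfSep P)) :
    IntermediateField (Kinf P) (Cinf P) :=
  E.map (IsScalarTower.toAlgHom (Kinf P) (KinfSep P) (Cinf P))

theorem Tate.exists_finiteDimensional_sub_mem_ball {ι : Type*} [Finite ι]
    (x : ι → Tate F A (Cinf P)) (r : {r : ℝ // 0 < r}) :
    ∃ E : IntermediateField (Kinf P) (KinfSep P), FiniteDimensional (Kinf P) E ∧
      ∀ i, ∃ y ∈ (Tate.mapAlg F A K ((cinfImage E).val.restrictScalars K)
        continuous_subtype_val).range, x i - y ∈ Tate.ball F A (Cinf P) r := by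
  have hdense : DenseRange (toCinfAlgHom P) := denseRange_toCinf P
  choose z hz using fun i => exists_sub_toTate_map_mem_ball (A := A) hdense (x i) r
  obtain ⟨N, hN, hzN⟩ :=
    TensorProduct.exists_finite_submodule_right_of_setFinite _ (Set.finite_range z)
  have : Finite N := Module.finite_of_finite F
  let E : IntermediateField (Kinf P) (KinfSep P) := .adjoin (Kinf P) N
  have hmem (w : A ⊗[F] N) :
      toTate F A (Cinf P) (Algebra.TensorProduct.map (.id F A) (toCinfAlgHom P)
        (N.subtype.lTensor A w)) ∈ (Tate.mapAlg F A K ((cinfImage E).val.restrictScalars K)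
          continuous_subtype_val).range := by
    induction w using TensorProduct.induction_on with
    | zero => simp only [map_zero, zero_mem]
    | add w w' hw hw' => simpa only [map_add] using add_mem hw hw'
    | tmul a c =>
      exact ⟨toTate F A (cinfImage E) (a ⊗ₜ ⟨toCinf P c, c,
        IntermediateField.subset_adjoin _ _ c.2, rfl⟩), Tate.mapAlg_toTate F A K _ _ _⟩
  refine ⟨E, IntermediateField.finiteDimensional_adjoin fun c _ => Algebra.IsIntegral.isIntegral c,
    fun i => ?_⟩
  obtain ⟨w, hw⟩ := hzN (Set.mem_range_self i)
  exact ⟨_, hmem w, hw ▸ hz i⟩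

/-- The Betti realization of `M` is contained in `M ⊗ L⟨A⟩`. -/
def BettiDefinedOver (M : AMotK P) (L : IntermediateField (Kinf P) (Cinf P)) : Prop :=
  ∀ ω ∈ M.betti (Cinf P), ω ∈ LinearMap.range
    (M.mapExt (L := L) (L' := Cinf P) (L.val.restrictScalars K) continuous_subtype_val)

variable [IsCurveFunctionField F K]

theorem bijective_toInv_Cinf (M : AMotK P) : Function.Bijective (M.toInv (Cinf P)) := by
  obtain ⟨u, hu, hunit⟩ := exists_clearsPoles_isUnit P
  exact hu.bijective_toInv (hunit (Cinf P) (norm_algebraMap_Cinf P)) M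

theorem bijective_toInv_intermediateField (M : AMotK P)
    (L : IntermediateField (Kinf P) (Cinf P)) : Function.Bijective (M.toInv L) := by
  obtain ⟨u, hu, hunit⟩ := exists_clearsPoles_isUnit P
  exact hu.bijective_toInv (hunit L (norm_algebraMap_Cinf P)) M

theorem exists_finiteDimensional_bettiDefinedOver {M : AMotK P}
    (hM : M.IsRigidAnalyticallyTrivial (Cinf P)) :
    ∃ E : IntermediateField (Kinf P) (KinfSep P), FiniteDimensional (Kinf P) E ∧
      BettiDefinedOver M (cinfImage E) := by
  have hb := bijective_toInv_Cinf M
  obtain ⟨n, m, ξ, h⟩ := exists_dual_sum_smul_eq (P.regularAway ⊗[F] K) M.carrier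
  obtain ⟨r, hr⟩ := Tate.exists_tendsto_iterate_frobMul (AMotive.frobMatrix hb m ξ)
  have := AMotive.finite_betti hM
  obtain ⟨W, hW⟩ := (Module.Finite.fg_top : (⊤ : Submodule P.regularAway (M.betti (Cinf P))).FG)
  obtain ⟨E, hE, hWE⟩ := Tate.exists_finiteDimensional_sub_mem_ball
    (fun wi : W × Fin n => (ξ wi.2).baseChange _ (wi.1 : M.betti (Cinf P)).1) r
  refine ⟨E, hE, fun _ => AMotive.mem_of_span_betti_eq_top hW fun w hw => ?_⟩
  choose y hy hwy using fun i => hWE (⟨w, hw⟩, i)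
  exact AMotive.mem_range_mapExt_of_tendsto (bijective_toInv_intermediateField M _) hb h
    (fun _ => rfl) _ w.2 hy (hr _ hwy)

theorem exists_finite_separable_bettiDefinedOver {M : AMotK P}
    (hM : M.IsRigidAnalyticallyTrivial (Cinf P)) :
    ∃ L : IntermediateField (Kinf P) (Cinf P), FiniteDimensional (Kinf P) L ∧
      Algebra.IsSeparable (Kinf P) L ∧ BettiDefinedOver M L := by
  obtain ⟨E, hE, h⟩ := exists_finiteDimensional_bettiDefinedOver hM
  have : Algebra.IsSeparable (Kinf P) (KinfSep P) := IsSepClosure.separable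
  have : Algebra.IsSeparable (Kinf P) E := inferInstance
  let e := E.equivMap (IsScalarTower.toAlgHom (Kinf P) (KinfSep P) (Cinf P))
  exact ⟨_, e.toLinearEquiv.finiteDimensional, AlgEquiv.Algebra.isSeparable e, h⟩

end FieldOfDefinition

section Continuity

theorem isContinuousRep_of_forall_isOpen {R G : Type u} [CommRing R] [Group G] [TopologicalSpace G]
    [ContinuousMul G] (V : Rep.{u} R G)
    (h : ∀ v, ∃ H : Subgroup G, IsOpen (H : Set G) ∧ ∀ σ ∈ H, V.ρ σ v = v) :
    IsContinuousRep R G V := by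
  let _ : TopologicalSpace V := ⊥
  have : DiscreteTopology V := ⟨rfl⟩
  refine continuous_prod_of_discrete_right.2 fun v => IsLocallyConstant.continuous ?_
  refine (IsLocallyConstant.iff_exists_open _).2 fun σ => ?_
  obtain ⟨H, hH, hv⟩ := h v
  refine ⟨(σ⁻¹ * ·) ⁻¹' H, hH.preimage (continuous_const_mul _), ?_, fun σ' hσ' => ?_⟩
  · rw [Set.mem_preimage, inv_mul_cancel]
    exact H.one_mem
  · calc V.ρ σ' v = V.ρ (σ * (σ⁻¹ * σ')) v := by rw [mul_inv_cancel_left]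
      _ = V.ρ σ v := by rw [map_mul, Module.End.mul_apply, hv _ hσ']

variable {F K : Type u} [Field F] [Fintype F] [Field K] [Algebra F K] {P : ClosedPoint F K}

theorem BettiDefinedOver.bettiRho_apply_eq {M : AMotK P}
    {E : IntermediateField (Kinf P) (KinfSep P)} (h : BettiDefinedOver M (cinfImage E))
    {σ : Ginf P} (hσ : σ ∈ E.fixingSubgroup) (ω : M.betti (Cinf P)) : bettiRho M σ ω = ω := by
  obtain ⟨y, hy⟩ := h ω ω.2
  refine Subtype.ext ?_
  rw [bettiRho_apply, ← hy]
  refine (AMotive.mapExt_comp M _ _ _ _ _ _ ?_ y).symm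
  rintro ⟨_, e, he, rfl⟩
  exact ((galCinf_toCinf P σ e).trans (congrArg (toCinf P) (hσ ⟨e, he⟩))).symm

theorem isContinuousRep_bettiRat [IsCurveFunctionField F K] (M : AMotRat P) :
    IsContinuousRep _ _ ((bettiRat P).obj M) := by
  obtain ⟨E, hE, h⟩ := exists_finiteDimensional_bettiDefinedOver M.property
  exact isContinuousRep_of_forall_isOpen _ fun ω =>
    ⟨E.fixingSubgroup, E.fixingSubgroup_isOpen, fun _ hσ => h.bettiRho_apply_eq hσ ω⟩

end Continuity

section Functor

variable {F K : Type u} [Field F] [Fintype F] [Field K] [Algebra F K] {P : ClosedPoint F K}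

instance : (bettiFunctor P).Additive where
  map_add {M _ f g} := Rep.hom_ext <| Representation.IntertwiningMap.ext <|
    LinearMap.ext fun (ω : M.betti (Cinf P)) => Subtype.ext <|
      LinearMap.congr_fun (LinearMap.lTensor_add _ f.lin g.lin) ω.1

theorem bettiCont_additive (hcont : ∀ M : AMotRat P, IsContinuousRep _ _ ((bettiRat P).obj M)) :
    (bettiCont hcont).Additive where
  map_add {_ _ f g} :=
    ObjectProperty.hom_ext _ ((bettiFunctor P).map_add (f := f.hom) (g := g.hom))

theorem AMotRat.IsShortExact.bettiCont_map [IsCurveFunctionField F K] {M' M M'' : AMotRat P}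
    {f : M' ⟶ M} {g : M ⟶ M''} (h : AMotRat.IsShortExact f g)
    (hcont : ∀ M : AMotRat P, IsContinuousRep _ _ ((bettiRat P).obj M)) :
    ContRep.IsShortExact ((bettiCont hcont).map f) ((bettiCont hcont).map g) := by
  obtain ⟨hf, hfg, hg⟩ := h
  have hb' := bijective_toInv_Cinf M'.obj
  have hb := bijective_toInv_Cinf M.obj
  have hb'' := bijective_toInv_Cinf M''.obj
  have hinj : Function.Injective (AMotive.bettiMap (Cinf P) f.hom) :=
    AMotive.injective_bettiMap hf hfg hg
  have hexact := AMotive.exact_bettiMap hb' hb hf hfg hg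
  have hsurj := AMotive.surjective_bettiMap hb' hb hb''
    (AMotive.exists_sub_frobExt_eq hb' Tate.exists_sub_frob_eq M'.property) hfg hg
  exact ⟨hinj, hexact, hsurj⟩

end Functor

end AMot

end

theorem mainTheorem9 {F K : Type u} [Field F] [Fintype F] [Field K] [Algebra F K]
    [IsCurveFunctionField F K] (P : ClosedPoint F K) :
    -- `M_B` is contained in `M ⊗ L⟨A⟩` for some finite separable `L / K_∞` in `ℂ_∞`
    (∀ M : AMotK P, M.IsRigidAnalyticallyTrivial (Cinf P) →
      ∃ L : IntermediateField (Kinf P) (Cinf P),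
        FiniteDimensional (Kinf P) L ∧ Algebra.IsSeparable (Kinf P) L ∧
        ∀ ω ∈ M.betti (Cinf P), ω ∈ LinearMap.range
          (M.mapExt (L := L) (L' := Cinf P) (L.val.restrictScalars K) continuous_subtype_val)) ∧
    -- `G_∞` acts continuously on the discrete module `M_B`, and the resulting functor is exact
    ∃ hcont : ∀ M : AMotRat P, IsContinuousRep _ _ ((bettiRat P).obj M),
      (bettiCont hcont).Additive ∧
      ∀ {M' M M'' : AMotRat P} (f : M' ⟶ M) (g : M ⟶ M''), AMotRat.IsShortExact f g →
        ContRep.IsShortExact ((bettiCont hcont).map f) ((bettiCont hcont).map g) := by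
  exact ⟨fun _ => exists_finite_separable_bettiDefinedOver, isContinuousRep_bettiRat,
    bettiCont_additive _, fun _ _ h => h.bettiCont_map _⟩
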